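/- **Gordon–Chevet inequality.** Let $E\neq\{0\}$ and $F$ be real Banach spaces, $x_1^*,\dots,x_n^*\in E^*$ and $f_1,\dots,f_d\in F$. Let $\{g_{i,k}\}_{1\le i\le n,\,1\le k\le d}$, $\{h_k\}_{1\le k\le d}$ and $\{g_i\}_{1\le i\le n}$ be mutually independent sets of orthonormal Gaussian random variables (each set is jointly Gaussian, centred, and orthonormal in $L^2$). Consider the random operator $T_\omega=\sum_{i=1}^n\sum_{k=1}^d g_{i,k}(\omega)\,x_i^*\otimes f_k$ from $E$ to $F$, that is, $T_\omega x=\sum_{i,k} g_{i,k}(\omega)\,x_i^*(x)f_k$, and put $$\varepsilon_2(x_1^*,\dots,x_n^*)=\sup_{\|x\|_E\le 1}\Big(\sum_{i=1}^n x_i^*(x)^2\Big)^{1/2},\qquad \varepsilon_2(f_1,\dots,f_d)=\sup_{y^*\in F^*,\ \|y^*\|\le 1}\Big(\sum_{k=1}^d y^*(f_k)^2\Big)^{1/2}.$$ Then $\|\sum_k h_kf_k\|_F$, $\|\sum_i g_ix_i^*\|_{E^*}$, $\min_{\|x\|=1}\|T_\omega x\|$ and $\max_{\|x\|=1}\|T_\omega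 x\|$ are integrable, and $$\inf_{\|x\|_E=1}\Big(\sum_{i=1}^n x_i^*(x)^2\Big)^{1/2}\,\mathbb E\Big\|\sum_{k=1}^d h_kf_k\Big\|_F-\varepsilon_2(f_1,\dots,f_d)\,\mathbb E\Big\|\sum_{i=1}^n g_ix_i^*\Big\|_{E^*}\le \mathbb E\min_{\|x\|_E=1}\|T_\omega x\|_F\le \mathbb E\max_{\|x\|_E=1}\|T_\omega x\|_F$$ $$\le \varepsilon_2(x_1^*,\dots,x_n^*)\,\mathbb E\Big\|\sum_{k=1}^d h_kf_k\Big\|_F+\varepsilon_2(f_1,\dots,f_d)\,\mathbb E\Big\|\sum_{i=1}^n g_ix_i^*\Big\|_{E^*}.$$ Here $\min$ and $\max$ over the unit sphere of $E$ are understood as infimum and supremum. -/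

import Mathlib

open MeasureTheory ProbabilityTheory

/-- A finite family of orthonormal Gaussian random variables: the family is jointly Gaussian,
centred, and orthonormal in `L²(P)`. -/
structure IsOrthonormalGaussian {Ω : Type*} [MeasurableSpace Ω] {ι : Type*} [Fintype ι]
    (ξ : ι → Ω → ℝ) (P : Measure Ω) : Prop where
  hasGaussianLaw : HasGaussianLaw (fun ω i => ξ i ω) P
  centered : ∀ i, ∫ ω, ξ i ω ∂P = 0
  unit : ∀ i, ∫ ω, ξ i ω ^ 2 ∂P = 1
  orthogonal : ∀ i j, i ≠ j → ∫ ω, ξ i ω * ξ j ω ∂P = 0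

/-- `ε₂(x₁*, …, xₙ*) = sup {(∑ᵢ xᵢ*(x)²)^{1/2} : ‖x‖ ≤ 1}` for functionals on `E`. -/
noncomputable def epsTwoDual {E : Type*} [NormedAddCommGroup E] [NormedSpace ℝ E] {n : ℕ}
    (xs : Fin n → StrongDual ℝ E) : ℝ :=
  sSup {r : ℝ | ∃ x : E, ‖x‖ ≤ 1 ∧ r = √(∑ i, (xs i x) ^ 2)}

/-- `ε₂(f₁, …, f_d) = sup {(∑ₖ y*(fₖ)²)^{1/2} : ‖y*‖ ≤ 1}` for vectors of `F`. -/
noncomputable def epsTwo {F : Type*} [NormedAddCommGroup F] [NormedSpace ℝ F] {d : ℕ}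
    (f : Fin d → F) : ℝ :=
  sSup {r : ℝ | ∃ y : StrongDual ℝ F, ‖y‖ ≤ 1 ∧ r = √(∑ k, (y (f k)) ^ 2)}

/-- The operator `∑ᵢ ∑ₖ aᵢₖ xᵢ* ⊗ fₖ` from `E` to `F`, where `(x* ⊗ f)(x) = x*(x) f`. -/
noncomputable def tensorOperator {E F : Type*} [NormedAddCommGroup E] [NormedSpace ℝ E]
    [NormedAddCommGroup F] [NormedSpace ℝ F] {n d : ℕ}
    (xs : Fin n → StrongDual ℝ E) (f : Fin d → F) (a : Fin n → Fin d → ℝ) : E →L[ℝ] F :=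
  ∑ i, ∑ k, a i k • (xs i).smulRight (f k)

/-- The minimum (infimum) of `‖T x‖` over the unit sphere of `E`. -/
noncomputable def sphereMin {E F : Type*} [NormedAddCommGroup E] [NormedSpace ℝ E]
    [NormedAddCommGroup F] [NormedSpace ℝ F] (T : E →L[ℝ] F) : ℝ :=
  sInf {r : ℝ | ∃ x : E, ‖x‖ = 1 ∧ r = ‖T x‖}

/-- The maximum (supremum) of `‖T x‖` over the unit sphere of `E`. -/
noncomputable def sphereMax {E F : Type*} [NormedAddCommGroup E] [NormedSpace ℝ E]
    [NormedAddCommGroup F] [NormedSpace ℝ F] (T : E →L[ℝ] F) : ℝ :=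
  sSup {r : ℝ | ∃ x : E, ‖x‖ = 1 ∧ r = ‖T x‖}

/-! The random form `y (T x) = ∑ᵢₖ gᵢₖ xᵢ*(x) y(fₖ)`, for `x` in the unit sphere of `E` and `y` in
the unit ball of `F*`, is compared with the decoupled process
`(∑ᵢ xᵢ*(x)²)^{1/2} ∑ₖ hₖ y(fₖ) + ε₂(f) ∑ᵢ gᵢ xᵢ*(x)`. Both are Gaussian; for equal `x` their
increments coincide, and for different `x` those of the second dominate
(`sum_mul_sub_mul_sq_le`). Hence the expected maximum over `x` and `y` is larger for the second
process (Sudakov–Fernique), and the expected minimum over `x` of the maximum over `y` is smaller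
(Gordon). For the form these are `max ‖T x‖` and `min ‖T x‖`; for the decoupled process they are
bounded pointwise by the two sides of the theorem.

Both comparisons are one statement about a smooth function. The two-level log-sum-exp
`log ∑ₓ (∑ᵧ exp zₓᵧ)ˢ` approximates `max max` for `s = 1` and `-min max` for `s = -1`, and for every
real `s` its mixed second derivatives between different rows are nonpositive, while its first
derivatives have constant sum. The two processes, realised on orthogonal coordinates of one standard
Gaussian vector, are joined by the rotation `cos θ · a + sin θ · b`; Gaussian integration by parts
(`integral_eval_mul_stdGaussianPi`) turns the derivative in `θ` into a pairing of the Hessian with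
the difference of the covariances, and because of the constant sum of first derivatives only the
increments matter (`hessian_lseTwo_pairing_nonneg`). Comparing increments rather than covariances is
what gives the constants `1`, with no additional Gaussian term.

The passage from finitely many `x` and `y` to the sphere and the ball uses finite nets for the
finitely many functionals `xᵢ*` and vectors `fₖ` (`IsMesh`), on which everything depends; the
entropy error of the log-sum-exp disappears on scaling the processes by `β → ∞`. -/

/-! ### Gaussian integration by parts -/

lemma hasDerivAt_gaussianPDFReal_std (t : ℝ) :
    HasDerivAt (gaussianPDFReal 0 1) (-(t * gaussianPDFReal 0 1 t)) t := by
  have h : HasDerivAt (fun x : ℝ => (√(2 * Real.pi * ((1 : NNReal) : ℝ)))⁻¹ *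
      Real.exp (-(x - 0) ^ 2 / (2 * ((1 : NNReal) : ℝ))))
      ((√(2 * Real.pi * ((1 : NNReal) : ℝ)))⁻¹ *
      (Real.exp (-(t - 0) ^ 2 / (2 * ((1 : NNReal) : ℝ))) * (-t))) t := by
    refine HasDerivAt.const_mul _ (HasDerivAt.exp ?_)
    have := (((hasDerivAt_id t).sub_const 0).pow 2).neg.div_const (2 * ((1 : NNReal) : ℝ))
    convert! this using 1
    simp
    ring
  rw [gaussianPDFReal_def]
  convert! h using 1
  ring

/-- Gaussian integration by parts on the line. -/
lemma integral_id_mul_gaussianReal_std {φ φ' : ℝ → ℝ} {C : ℝ}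
    (hφ : ∀ t, HasDerivAt φ (φ' t) t) (hφ' : Continuous φ')
    (hC : ∀ t, |φ t| ≤ C) (hC' : ∀ t, |φ' t| ≤ C) :
    ∫ t, t * φ t ∂(gaussianReal 0 1) = ∫ t, φ' t ∂(gaussianReal 0 1) := by
  have hcont : Continuous φ := continuous_iff_continuousAt.2 fun t => (hφ t).continuousAt
  have hid : Integrable (fun t : ℝ => t * gaussianPDFReal 0 1 t) := by
    have h1 : Integrable (fun t : ℝ => t) (gaussianReal 0 1) :=
      memLp_one_iff_integrable.1 (memLp_id_gaussianReal' 1 (by simp))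
    rw [gaussianReal_of_var_ne_zero 0 one_ne_zero,
      integrable_withDensity_iff_integrable_smul₀' (by fun_prop)
        (by simp [gaussianPDF])] at h1
    refine h1.congr (Filter.Eventually.of_forall fun t => ?_)
    simp [toReal_gaussianPDF, mul_comm]
  rw [integral_gaussianReal_eq_integral_smul one_ne_zero,
    integral_gaussianReal_eq_integral_smul one_ne_zero]
  have key := integral_mul_deriv_eq_deriv_mul_of_integrable
    (u := gaussianPDFReal 0 1) (v := φ) (u' := fun t => -(t * gaussianPDFReal 0 1 t)) (v' := φ')
    (fun t _ => hasDerivAt_gaussianPDFReal_std t) (fun t _ => hφ t)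
    ((integrable_gaussianPDFReal 0 1).mul_bdd (c := C) hφ'.aestronglyMeasurable
      (Filter.Eventually.of_forall hC'))
    (hid.neg.mul_bdd (c := C) hcont.aestronglyMeasurable (Filter.Eventually.of_forall hC))
    ((integrable_gaussianPDFReal 0 1).mul_bdd (c := C) hcont.aestronglyMeasurable
      (Filter.Eventually.of_forall hC))
  simp only [smul_eq_mul]
  rw [key, ← integral_neg]
  congr 1 with t
  ring

/-- Resampling one coordinate of a product measure leaves it invariant. -/
lemma measurePreserving_update {κ α : Type*} [Fintype κ] [DecidableEq κ] [MeasurableSpace α]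
    (μ : Measure α) [IsProbabilityMeasure μ] (m : κ) :
    MeasurePreserving (fun p : α × (κ → α) => Function.update p.2 m p.1)
      (μ.prod (Measure.pi fun _ => μ)) (Measure.pi fun _ => μ) := by
  have hmeas : Measurable (fun p : α × (κ → α) => Function.update p.2 m p.1) := by
    refine measurable_pi_lambda _ fun k => ?_
    by_cases h : k = m
    · subst h; simpa using measurable_fst
    · simp only [Function.update_of_ne h]
      exact (measurable_pi_apply k).comp measurable_snd
  refine ⟨hmeas, (Measure.pi_eq fun s hs => ?_).symm⟩
  rw [Measure.map_apply hmeas (MeasurableSet.univ_pi hs)]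
  have : (fun p : α × (κ → α) => Function.update p.2 m p.1) ⁻¹' (Set.univ.pi s)
      = s m ×ˢ Set.univ.pi (Function.update s m Set.univ) := by
    ext p
    simp only [Set.mem_preimage, Set.mem_pi, Set.mem_univ, true_imp_iff, Set.mem_prod]
    constructor
    · intro h
      refine ⟨by simpa using h m, fun k => ?_⟩
      by_cases hk : k = m
      · subst hk; simp
      · simpa [hk] using h k
    · rintro ⟨h1, h2⟩ k
      by_cases hk : k = m
      · subst hk; simpa using h1
      · simpa [hk] using h2 k
  rw [this, Measure.prod_prod, Measure.pi_pi,
    ← Finset.mul_prod_erase _ _ (Finset.mem_univ m),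
    ← Finset.mul_prod_erase _ (fun i => μ (s i)) (Finset.mem_univ m)]
  simp only [Function.update_self, measure_univ, one_mul]
  congr 1
  exact Finset.prod_congr rfl fun k hk => by rw [Function.update_of_ne (Finset.ne_of_mem_erase hk)]

/-- The standard Gaussian measure on `κ → ℝ`. -/
noncomputable abbrev stdGaussianPi (κ : Type*) [Fintype κ] : Measure (κ → ℝ) :=
  Measure.pi fun _ => gaussianReal 0 1

lemma integrable_eval_stdGaussianPi {κ : Type*} [Fintype κ] (m : κ) :
    Integrable (fun x : κ → ℝ => x m) (stdGaussianPi κ) := by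
  have h1 : Integrable (fun t : ℝ => t) (gaussianReal 0 1) :=
      memLp_one_iff_integrable.1 (memLp_id_gaussianReal' 1 (by simp))
  exact (measurePreserving_eval (fun _ : κ => gaussianReal 0 1) m).integrable_comp_of_integrable h1

/-- Gaussian integration by parts in one coordinate of the standard Gaussian measure. -/
lemma integral_eval_mul_stdGaussianPi {κ : Type*} [Fintype κ] [DecidableEq κ] (m : κ)
    {φ φ' : (κ → ℝ) → ℝ} {C : ℝ}
    (hφ : ∀ x t, HasDerivAt (fun r => φ (Function.update x m r)) (φ' (Function.update x m t)) t)
    (hcont : Continuous φ) (hcont' : Continuous φ')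
    (hC : ∀ x, |φ x| ≤ C) (hC' : ∀ x, |φ' x| ≤ C) :
    ∫ x, x m * φ x ∂(stdGaussianPi κ) = ∫ x, φ' x ∂(stdGaussianPi κ) := by
  have hmp : MeasurePreserving _ _ (stdGaussianPi κ) :=
    measurePreserving_update (gaussianReal 0 1) m
  have hi1 : Integrable (fun x : κ → ℝ => x m * φ x) (stdGaussianPi κ) :=
    (integrable_eval_stdGaussianPi m).mul_bdd (c := C) hcont.aestronglyMeasurable
      (Filter.Eventually.of_forall hC)
  have hi2 : Integrable φ' (stdGaussianPi κ) :=
    Integrable.of_bound hcont'.aestronglyMeasurable C (Filter.Eventually.of_forall hC')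
  rw [← hmp.map_eq] at hi1 hi2 ⊢
  rw [integral_map hmp.aemeasurable hi1.aestronglyMeasurable,
    integral_map hmp.aemeasurable hi2.aestronglyMeasurable]
  have hi1' := hi1.comp_aemeasurable hmp.aemeasurable
  have hi2' := hi2.comp_aemeasurable hmp.aemeasurable
  simp only [Function.comp_def] at hi1' hi2'
  rw [integral_prod_symm _ hi1', integral_prod_symm _ hi2']
  congr 1 with x
  simp only [Function.update_self]
  exact integral_id_mul_gaussianReal_std (hφ x)
    (hcont'.comp (continuous_const.update m continuous_id)) (fun _ => hC _) (fun _ => hC' _)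

/-! ### Log-sum-exp functions -/

section LogSumExp
variable {I J : Type*} [Fintype I] [Fintype J] [Nonempty I] [Nonempty J]

/-- The log-sum-exp function `log (∑ᵢ exp zᵢ)`, a smooth approximation of the maximum. -/
noncomputable def lse (z : I → ℝ) : ℝ := Real.log (∑ i, Real.exp (z i))

/-- The softmax weights `exp zᵢ / ∑ₗ exp zₗ`, the gradient of `lse`. -/
noncomputable def softmax (z : I → ℝ) (i : I) : ℝ := Real.exp (z i - lse z)

omit [Nonempty I] in
lemma softmax_pos (z : I → ℝ) (i : I) : 0 < softmax z i := Real.exp_pos _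

lemma sum_exp_pos (z : I → ℝ) : 0 < ∑ i, Real.exp (z i) :=
  Finset.sum_pos (fun _ _ => Real.exp_pos _) Finset.univ_nonempty

lemma sum_softmax (z : I → ℝ) : ∑ i, softmax z i = 1 := by
  have h := sum_exp_pos z
  simp only [softmax, Real.exp_sub, ← Finset.sum_div, lse, Real.exp_log h]
  exact div_self h.ne'

lemma softmax_le_one (z : I → ℝ) (i : I) : softmax z i ≤ 1 := by
  rw [← sum_softmax z]
  exact Finset.single_le_sum (fun l _ => (softmax_pos z l).le) (Finset.mem_univ i)

lemma le_lse (z : I → ℝ) (i : I) : z i ≤ lse z := by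
  have := softmax_le_one z i
  rw [softmax, Real.exp_le_one_iff] at this
  linarith

lemma lse_le {z : I → ℝ} {M : ℝ} (h : ∀ i, z i ≤ M) : lse z ≤ M + Real.log (Fintype.card I) := by
  have hI : (0 : ℝ) < Fintype.card I := by exact_mod_cast Fintype.card_pos
  rw [lse, Real.log_le_iff_le_exp (sum_exp_pos z), Real.exp_add, Real.exp_log hI]
  calc ∑ i, Real.exp (z i) ≤ ∑ _i : I, Real.exp M :=
        Finset.sum_le_sum fun i _ => Real.exp_le_exp.2 (h i)
    _ = Real.exp M * Fintype.card I := by simp [mul_comm]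

lemma abs_lse_le {z : I → ℝ} {M : ℝ} (h : ∀ i, |z i| ≤ M) :
    |lse z| ≤ M + Real.log (Fintype.card I) := by
  have hI : (0 : ℝ) ≤ Real.log (Fintype.card I) := Real.log_natCast_nonneg _
  refine abs_le.2 ⟨?_, lse_le fun i => (le_abs_self _).trans (h i)⟩
  obtain ⟨i⟩ := ‹Nonempty I›
  have h1 := le_lse z i
  have h2 := neg_abs_le (z i)
  have h3 := h i
  linarith

lemma continuous_lse : Continuous (lse : (I → ℝ) → ℝ) := by
  unfold lse
  exact Continuous.log (by fun_prop) fun z => (sum_exp_pos z).ne'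

lemma continuous_softmax (i : I) : Continuous (fun z : I → ℝ => softmax z i) := by
  unfold softmax
  exact Real.continuous_exp.comp ((continuous_apply i).sub continuous_lse)

lemma hasDerivAt_lse {z : ℝ → I → ℝ} {z' : I → ℝ} {t : ℝ}
    (hz : ∀ i, HasDerivAt (fun r => z r i) (z' i) t) :
    HasDerivAt (fun r => lse (z r)) (∑ i, softmax (z t) i * z' i) t := by
  have h := sum_exp_pos (z t)
  have := (HasDerivAt.fun_sum (u := Finset.univ) fun i _ => (hz i).exp).log h.ne'
  refine this.congr_deriv ?_
  rw [Finset.sum_div]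
  refine Finset.sum_congr rfl fun i _ => ?_
  rw [softmax, Real.exp_sub, lse, Real.exp_log h]
  ring

lemma hasDerivAt_softmax {z : ℝ → I → ℝ} {z' : I → ℝ} {t : ℝ}
    (hz : ∀ i, HasDerivAt (fun r => z r i) (z' i) t) (i : I) :
    HasDerivAt (fun r => softmax (z r) i)
      (softmax (z t) i * (z' i - ∑ l, softmax (z t) l * z' l)) t :=
  ((hz i).sub (hasDerivAt_lse hz)).exp

/-- The two-level log-sum-exp `log ∑ᵢ (∑ⱼ exp zᵢⱼ)ˢ`. It approximates `maxᵢ maxⱼ zᵢⱼ` for `s = 1`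
and `-minᵢ maxⱼ zᵢⱼ` for `s = -1`. -/
noncomputable def lseTwo (s : ℝ) (z : I → J → ℝ) : ℝ := lse fun i => s * lse (z i)

/-- The weight of the `i`-th row in the gradient of `lseTwo s`. -/
noncomputable def rowWeight (s : ℝ) (z : I → J → ℝ) (i : I) : ℝ :=
  softmax (fun l => s * lse (z l)) i

omit [Nonempty I] [Nonempty J] in
lemma rowWeight_pos (s : ℝ) (z : I → J → ℝ) (i : I) : 0 < rowWeight s z i := softmax_pos _ _

omit [Nonempty J] in
lemma rowWeight_le_one (s : ℝ) (z : I → J → ℝ) (i : I) : rowWeight s z i ≤ 1 := softmax_le_one _ _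

omit [Nonempty J] in
lemma sum_rowWeight (s : ℝ) (z : I → J → ℝ) : ∑ i, rowWeight s z i = 1 := sum_softmax _

omit [Fintype I] [Nonempty I] in
lemma continuous_lse_row (s : ℝ) :
    Continuous (fun (z : I → J → ℝ) (i : I) => s * lse (z i)) :=
  continuous_pi fun i => continuous_const.mul (continuous_lse.comp (continuous_apply i))

lemma continuous_lseTwo (s : ℝ) : Continuous (lseTwo s : (I → J → ℝ) → ℝ) :=
  continuous_lse.comp (continuous_lse_row s)

lemma continuous_rowWeight (s : ℝ) (i : I) :
    Continuous (fun z : I → J → ℝ => rowWeight s z i) :=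
  (continuous_softmax i).comp (continuous_lse_row s)

lemma hasDerivAt_lseTwo (s : ℝ) {z : ℝ → I → J → ℝ} {z' : I → J → ℝ} {t : ℝ}
    (hz : ∀ i j, HasDerivAt (fun r => z r i j) (z' i j) t) :
    HasDerivAt (fun r => lseTwo s (z r))
      (∑ i, ∑ j, s * (rowWeight s (z t) i * softmax (z t i) j) * z' i j) t := by
  refine (hasDerivAt_lse fun i => (hasDerivAt_lse (hz i)).const_mul s).congr_deriv ?_
  refine Finset.sum_congr rfl fun i _ => ?_
  rw [Finset.mul_sum, Finset.mul_sum]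
  exact Finset.sum_congr rfl fun j _ => by rw [rowWeight]; ring

/-- The derivative of the partial derivative of `lseTwo s` in the `(i, j)` entry (up to the factor
`s`). -/
lemma hasDerivAt_gradient_lseTwo (s : ℝ) {z : ℝ → I → J → ℝ} {z' : I → J → ℝ} {t : ℝ}
    (hz : ∀ i j, HasDerivAt (fun r => z r i j) (z' i j) t) (i : I) (j : J) :
    HasDerivAt (fun r => rowWeight s (z r) i * softmax (z r i) j)
      (rowWeight s (z t) i * softmax (z t i) j *
        (z' i j + (s - 1) * ∑ k, softmax (z t i) k * z' i k
          - s * ∑ l, ∑ k, rowWeight s (z t) l * softmax (z t l) k * z' l k)) t := by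
  have h1 := hasDerivAt_softmax (fun l => (hasDerivAt_lse (hz l)).const_mul s) i
  refine (h1.mul (hasDerivAt_softmax (hz i) j)).congr_deriv ?_
  have : ∑ l, softmax (fun l => s * lse (z t l)) l *
      (s * ∑ k, softmax (z t l) k * z' l k) =
      s * ∑ l, ∑ k, rowWeight s (z t) l * softmax (z t l) k * z' l k := by
    simp only [Finset.mul_sum, rowWeight]
    exact Finset.sum_congr rfl fun l _ => Finset.sum_congr rfl fun k _ => by ring
  rw [this]
  simp only [rowWeight]
  ring

lemma abs_lseTwo_le (s : ℝ) {z : I → J → ℝ} {M : ℝ} (h : ∀ i j, |z i j| ≤ M) :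
    |lseTwo s z| ≤ |s| * (M + Real.log (Fintype.card J)) + Real.log (Fintype.card I) :=
  abs_lse_le fun i => by
    rw [abs_mul]
    exact mul_le_mul_of_nonneg_left (abs_lse_le (h i)) (abs_nonneg s)

end LogSumExp

/-! ### The Hessian of the two-level log-sum-exp along linear forms -/

section Comparison
variable {I J κ : Type*} [Fintype I] [Fintype J] [Fintype κ]

/-- The matrix of linear forms `∑ₘ aᵢⱼₘ xₘ`. -/
def linForms (a : I → J → κ → ℝ) (x : κ → ℝ) (i : I) (j : J) : ℝ := ∑ m, a i j m * x m

omit [Fintype I] [Fintype J] in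
lemma continuous_linForms (a : I → J → κ → ℝ) : Continuous (linForms a) := by
  unfold linForms
  fun_prop

omit [Fintype I] [Fintype J] in
lemma hasDerivAt_linForms_update [DecidableEq κ] (a : I → J → κ → ℝ) (x : κ → ℝ) (m : κ) (i : I)
    (j : J) (t : ℝ) :
    HasDerivAt (fun r => linForms a (Function.update x m r) i j) (a i j m) t := by
  have h : ∀ k, HasDerivAt (fun r => a i j k * Function.update x m r k)
      (a i j k * if k = m then 1 else 0) t := by
    intro k
    refine HasDerivAt.const_mul _ ?_
    by_cases hk : k = m
    · subst hk; simpa using! hasDerivAt_id t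
    · simpa [hk] using hasDerivAt_const t (x k)
  exact (HasDerivAt.fun_sum (u := Finset.univ) fun k _ => h k).congr_deriv (by simp)

/-- The algebraic core of the comparison: weighted by the second derivatives of `lseTwo s`, a
symmetric matrix whose increments vanish inside rows and are nonnegative between rows has a
nonnegative sum. -/
lemma hessian_lseTwo_pairing_nonneg (s : ℝ) {w : I → ℝ} {q : I → J → ℝ} (hw : ∀ i, 0 ≤ w i)
    (hq : ∀ i j, 0 ≤ q i j) (hw1 : ∑ i, w i = 1) (hq1 : ∀ i, ∑ j, q i j = 1)
    {M : I → J → I → J → ℝ}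
    (hsame : ∀ i j k, M i j i j + M i k i k - 2 * M i j i k = 0)
    (hdiff : ∀ i j l k, 0 ≤ M i j i j + M l k l k - 2 * M i j l k) :
    0 ≤ ∑ i, ∑ j, s * (w i * q i j * (M i j i j + (s - 1) * ∑ k, q i k * M i j i k
          - s * ∑ l, ∑ k, w l * q l k * M i j l k)) := by
  set m : ℝ := ∑ i, ∑ j, w i * q i j * M i j i j with hm
  have hwq : ∑ i, ∑ j, w i * q i j = 1 := by
    simp [← Finset.mul_sum, hq1, hw1]
  -- inside a row the increments vanish, so off-diagonal entries average to diagonal ones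
  have h2 : ∑ i, ∑ j, w i * q i j * ∑ k, q i k * M i j i k = m := by
    refine Finset.sum_congr rfl fun i _ => ?_
    have e1 : ∀ j, w i * q i j * ∑ k, q i k * M i j i k
        = (w i / 2) * (q i j * M i j i j) + (w i / 2) * (q i j * ∑ k, q i k * M i k i k) := by
      intro j
      have : ∑ k, q i k * M i j i k = ∑ k, (q i k * (M i j i j / 2) + q i k * M i k i k / 2) :=
        Finset.sum_congr rfl fun k _ => by
          have := hsame i j k
          rw [show M i j i k = (M i j i j + M i k i k) / 2 by linarith]; ring
      rw [this, Finset.sum_add_distrib, ← Finset.sum_mul, hq1, ← Finset.sum_div]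
      ring
    simp_rw [e1]
    rw [Finset.sum_add_distrib, ← Finset.mul_sum, ← Finset.mul_sum, ← Finset.sum_mul, hq1]
    simp only [mul_assoc, ← Finset.mul_sum]
    ring
  -- polarisation `2 M_pq = M_pp + M_qq - D_pq` leaves only the nonnegative increments `D`
  set D : ℝ := ∑ i, ∑ j, w i * q i j * ∑ l, ∑ k, w l * q l k *
    (M i j i j + M l k l k - 2 * M i j l k) with hD
  have hDnn : 0 ≤ D := by
    refine Finset.sum_nonneg fun i _ => Finset.sum_nonneg fun j _ => mul_nonneg
      (mul_nonneg (hw i) (hq i j)) (Finset.sum_nonneg fun l _ => Finset.sum_nonneg fun k _ =>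
        mul_nonneg (mul_nonneg (hw l) (hq l k)) (hdiff i j l k))
  have h3 : D = 2 * m - 2 * ∑ i, ∑ j, w i * q i j * ∑ l, ∑ k, w l * q l k * M i j l k := by
    have e : ∀ i j, ∑ l, ∑ k, w l * q l k * (M i j i j + M l k l k - 2 * M i j l k)
        = M i j i j + m - 2 * ∑ l, ∑ k, w l * q l k * M i j l k := by
      intro i j
      have : ∀ l k, w l * q l k * (M i j i j + M l k l k - 2 * M i j l k)
        = w l * q l k * M i j i j + w l * q l k * M l k l k - 2 * (w l * q l k * M i j l k) := by
        intros; ring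
      simp_rw [this, Finset.sum_sub_distrib, Finset.sum_add_distrib, ← Finset.sum_mul, hwq,
        ← Finset.mul_sum, one_mul, hm]
    simp_rw [hD, e, mul_sub, mul_add, Finset.sum_sub_distrib, Finset.sum_add_distrib,
      ← Finset.sum_mul, hwq, ← hm, mul_left_comm _ (2 : ℝ), ← Finset.mul_sum]
    ring
  have key : ∑ i, ∑ j, s * (w i * q i j * (M i j i j + (s - 1) * ∑ k, q i k * M i j i k
          - s * ∑ l, ∑ k, w l * q l k * M i j l k)) = s ^ 2 / 2 * D := by
    simp_rw [mul_sub, mul_add, Finset.sum_sub_distrib, Finset.sum_add_distrib,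
      mul_left_comm _ (s - 1), mul_left_comm _ s, ← Finset.mul_sum, h2, ← hm, h3]
    ring
  rw [key]
  positivity

end Comparison

/-! ### Gaussian interpolation -/

section Interpolation
variable {I J κ : Type*} [Fintype I] [Fintype J] [Fintype κ] [Nonempty I] [Nonempty J]

omit [Fintype I] [Fintype J] [Nonempty I] [Nonempty J] in
lemma integrable_linForms (a : I → J → κ → ℝ) (i : I) (j : J) :
    Integrable (fun x => linForms a x i j) (stdGaussianPi κ) :=
  integrable_finsetSum _ fun m _ => (integrable_eval_stdGaussianPi m).const_mul _

lemma integrable_lseTwo_linForms (s : ℝ) (a : I → J → κ → ℝ) :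
    Integrable (fun x => lseTwo s (linForms a x)) (stdGaussianPi κ) := by
  have hb : Integrable (fun x => |s| * ((∑ i, ∑ j, |linForms a x i j|)
      + Real.log (Fintype.card J)) + Real.log (Fintype.card I)) (stdGaussianPi κ) :=
    (((integrable_finsetSum _ fun i _ => integrable_finsetSum _ fun j _ =>
      (integrable_linForms a i j).abs).add (integrable_const _)).const_mul _).add
      (integrable_const _)
  refine hb.mono' ((continuous_lseTwo s).comp (continuous_linForms a)).aestronglyMeasurable
    (Filter.Eventually.of_forall fun x => abs_lseTwo_le s fun i j => ?_)
  exact (Finset.single_le_sum (f := fun j => |linForms a x i j|) (fun _ _ => abs_nonneg _)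
    (Finset.mem_univ j)).trans (Finset.single_le_sum (f := fun i => ∑ j, |linForms a x i j|)
      (fun _ _ => Finset.sum_nonneg fun _ _ => abs_nonneg _) (Finset.mem_univ i))

lemma rowWeight_mul_softmax_mem (s : ℝ) (z : I → J → ℝ) (i : I) (j : J) :
    0 ≤ rowWeight s z i * softmax (z i) j ∧ rowWeight s z i * softmax (z i) j ≤ 1 :=
  ⟨mul_nonneg (rowWeight_pos s z i).le (softmax_pos _ j).le,
    mul_le_one₀ (rowWeight_le_one s z i) (softmax_pos _ j).le (softmax_le_one _ j)⟩

lemma continuous_gradient_lseTwo (s : ℝ) (i : I) (j : J) :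
    Continuous fun z : I → J → ℝ => rowWeight s z i * softmax (z i) j :=
  (continuous_rowWeight s i).mul ((continuous_softmax j).comp (continuous_apply i))

/-- Gaussian integration by parts for the gradient of `lseTwo s` along linear images of the
standard Gaussian measure. -/
lemma integral_eval_mul_gradient_lseTwo (s : ℝ) (c : I → J → κ → ℝ) (m : κ) (i : I) (j : J) :
    Integrable (fun x => rowWeight s (linForms c x) i * softmax (linForms c x i) j *
        (c i j m + (s - 1) * ∑ k, softmax (linForms c x i) k * c i k m
          - s * ∑ l, ∑ k, rowWeight s (linForms c x) l * softmax (linForms c x l) k * c l k m))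
      (stdGaussianPi κ) ∧
    ∫ x, x m * (rowWeight s (linForms c x) i * softmax (linForms c x i) j) ∂(stdGaussianPi κ)
      = ∫ x, rowWeight s (linForms c x) i * softmax (linForms c x i) j *
        (c i j m + (s - 1) * ∑ k, softmax (linForms c x i) k * c i k m
          - s * ∑ l, ∑ k, rowWeight s (linForms c x) l * softmax (linForms c x l) k * c l k m)
        ∂(stdGaussianPi κ) := by
  classical
  have hc1 : ∀ l k, Continuous fun x : κ → ℝ =>
      rowWeight s (linForms c x) l * softmax (linForms c x l) k := fun l k =>
    (continuous_gradient_lseTwo s l k).comp (continuous_linForms c)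
  have hc0 : ∀ k, Continuous fun x : κ → ℝ => softmax (linForms c x i) k := fun k =>
    (continuous_softmax k).comp ((continuous_apply i).comp (continuous_linForms c))
  have hc2 : Continuous fun x => rowWeight s (linForms c x) i * softmax (linForms c x i) j *
        (c i j m + (s - 1) * ∑ k, softmax (linForms c x i) k * c i k m
          - s * ∑ l, ∑ k, rowWeight s (linForms c x) l * softmax (linForms c x l) k * c l k m) := by
    refine (hc1 i j).mul ((continuous_const.add (continuous_const.mul
      (continuous_finsetSum _ fun k _ => (hc0 k).mul continuous_const))).sub
      (continuous_const.mul (continuous_finsetSum _ fun l _ => continuous_finsetSum _ fun k _ =>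
        (hc1 l k).mul continuous_const)))
  set B : ℝ := |c i j m| + |s - 1| * (∑ k, |c i k m|) + |s| * ∑ l, ∑ k, |c l k m| with hB
  have hbound : ∀ x : κ → ℝ, |rowWeight s (linForms c x) i * softmax (linForms c x i) j *
        (c i j m + (s - 1) * ∑ k, softmax (linForms c x i) k * c i k m
          - s * ∑ l, ∑ k, rowWeight s (linForms c x) l * softmax (linForms c x l) k * c l k m)|
          ≤ B := by
    intro x
    rw [abs_mul]
    have hp := rowWeight_mul_softmax_mem s (linForms c x) i j
    have h1 : |∑ k, softmax (linForms c x i) k * c i k m| ≤ ∑ k, |c i k m| := by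
      refine (Finset.abs_sum_le_sum_abs _ _).trans (Finset.sum_le_sum fun k _ => ?_)
      rw [abs_mul, abs_of_pos (softmax_pos _ _)]
      exact mul_le_of_le_one_left (abs_nonneg _) (softmax_le_one _ _)
    have h2 : |∑ l, ∑ k, rowWeight s (linForms c x) l * softmax (linForms c x l) k * c l k m|
        ≤ ∑ l, ∑ k, |c l k m| := by
      refine (Finset.abs_sum_le_sum_abs _ _).trans (Finset.sum_le_sum fun l _ =>
        (Finset.abs_sum_le_sum_abs _ _).trans (Finset.sum_le_sum fun k _ => ?_))
      have hp := rowWeight_mul_softmax_mem s (linForms c x) l k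
      rw [abs_mul, abs_of_nonneg hp.1]
      exact mul_le_of_le_one_left (abs_nonneg _) hp.2
    rw [abs_of_nonneg hp.1]
    refine (mul_le_of_le_one_left (abs_nonneg _) hp.2).trans ?_
    refine (abs_sub _ _).trans (add_le_add ((abs_add_le _ _).trans (add_le_add le_rfl ?_)) ?_)
    · rw [abs_mul]; exact mul_le_mul_of_nonneg_left h1 (abs_nonneg _)
    · rw [abs_mul]; exact mul_le_mul_of_nonneg_left h2 (abs_nonneg _)
  refine ⟨Integrable.of_bound hc2.aestronglyMeasurable B (Filter.Eventually.of_forall hbound), ?_⟩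
  refine integral_eval_mul_stdGaussianPi (C := 1 + B) m
    (φ := fun x => rowWeight s (linForms c x) i * softmax (linForms c x i) j)
    (φ' := fun x => rowWeight s (linForms c x) i * softmax (linForms c x i) j *
        (c i j m + (s - 1) * ∑ k, softmax (linForms c x i) k * c i k m
          - s * ∑ l, ∑ k, rowWeight s (linForms c x) l * softmax (linForms c x l) k * c l k m))
    (fun x t => ?_) (hc1 i j) hc2 (fun x => ?_) (fun x => ?_)
  · exact hasDerivAt_gradient_lseTwo s
      (fun i j => hasDerivAt_linForms_update c x m i j t) i j
  · have hp := rowWeight_mul_softmax_mem s (linForms c x) i j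
    have := (abs_nonneg _).trans (hbound x)
    rw [abs_of_nonneg hp.1]
    linarith [hp.2]
  · linarith [hbound x]

/-- The derivative of the interpolated expectation is nonnegative: after integration by parts it is
a pairing of the Hessian of `lseTwo s` with the matrix `∑ₘ c'ᵢⱼₘ cₗₖₘ`. -/
lemma integral_gradient_lseTwo_nonneg (s : ℝ) (c c' : I → J → κ → ℝ)
    (hsame : ∀ i j k, ∑ m, c' i j m * c i j m + ∑ m, c' i k m * c i k m
      - 2 * ∑ m, c' i j m * c i k m = 0)
    (hdiff : ∀ i j l k, 0 ≤ ∑ m, c' i j m * c i j m + ∑ m, c' l k m * c l k m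
      - 2 * ∑ m, c' i j m * c l k m) :
    0 ≤ ∫ x, ∑ i, ∑ j, s * (rowWeight s (linForms c x) i * softmax (linForms c x i) j)
      * linForms c' x i j ∂(stdGaussianPi κ) := by
  have hint : ∀ i j m, Integrable (fun x : κ → ℝ =>
      x m * (rowWeight s (linForms c x) i * softmax (linForms c x i) j)) (stdGaussianPi κ) :=
    fun i j m => (integrable_eval_stdGaussianPi m).mul_bdd (c := 1)
      ((continuous_gradient_lseTwo s i j).comp (continuous_linForms c)).aestronglyMeasurable
      (Filter.Eventually.of_forall fun x => by
        have hp := rowWeight_mul_softmax_mem s (linForms c x) i j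
        simpa only [Real.norm_of_nonneg hp.1] using hp.2)
  have e1 : ∀ x : κ → ℝ, ∑ i, ∑ j, s * (rowWeight s (linForms c x) i * softmax (linForms c x i) j)
      * linForms c' x i j = ∑ i, ∑ j, ∑ m, s * c' i j m *
        (x m * (rowWeight s (linForms c x) i * softmax (linForms c x i) j)) := by
    intro x
    refine Finset.sum_congr rfl fun i _ => Finset.sum_congr rfl fun j _ => ?_
    rw [linForms, Finset.mul_sum]
    exact Finset.sum_congr rfl fun m _ => by ring
  have e2 : ∫ x, ∑ i, ∑ j, s * (rowWeight s (linForms c x) i * softmax (linForms c x i) j)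
      * linForms c' x i j ∂(stdGaussianPi κ) = ∫ x, ∑ i, ∑ j, ∑ m, s * c' i j m *
        (rowWeight s (linForms c x) i * softmax (linForms c x i) j *
        (c i j m + (s - 1) * ∑ k, softmax (linForms c x i) k * c i k m
          - s * ∑ l, ∑ k, rowWeight s (linForms c x) l * softmax (linForms c x l) k * c l k m))
        ∂(stdGaussianPi κ) := by
    simp_rw [e1]
    rw [integral_finsetSum _ fun i _ => integrable_finsetSum _ fun j _ =>
        integrable_finsetSum _ fun m _ => (hint i j m).const_mul _,
      integral_finsetSum _ fun i _ => integrable_finsetSum _ fun j _ =>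
        integrable_finsetSum _ fun m _ =>
          (integral_eval_mul_gradient_lseTwo s c m i j).1.const_mul _]
    refine Finset.sum_congr rfl fun i _ => ?_
    rw [integral_finsetSum _ fun j _ =>
        integrable_finsetSum _ fun m _ => (hint i j m).const_mul _,
      integral_finsetSum _ fun j _ => integrable_finsetSum _ fun m _ =>
          (integral_eval_mul_gradient_lseTwo s c m i j).1.const_mul _]
    refine Finset.sum_congr rfl fun j _ => ?_
    rw [integral_finsetSum _ fun m _ => (hint i j m).const_mul _,
      integral_finsetSum _ fun m _ =>
          (integral_eval_mul_gradient_lseTwo s c m i j).1.const_mul _]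
    refine Finset.sum_congr rfl fun m _ => ?_
    rw [integral_const_mul, integral_const_mul, (integral_eval_mul_gradient_lseTwo s c m i j).2]
  rw [e2]
  refine integral_nonneg fun x => ?_
  have := hessian_lseTwo_pairing_nonneg s (w := rowWeight s (linForms c x))
    (q := fun i => softmax (linForms c x i)) (fun i => (rowWeight_pos _ _ i).le)
    (fun i j => (softmax_pos _ _).le) (sum_rowWeight _ _) (fun i => sum_softmax _)
    (M := fun i j l k => ∑ m, c' i j m * c l k m) hsame hdiff
  refine this.trans_eq (Finset.sum_congr rfl fun i _ => Finset.sum_congr rfl fun j _ => ?_)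
  have h1 : ∑ k, softmax (linForms c x i) k * ∑ m, c' i j m * c i k m =
      ∑ m, c' i j m * ∑ k, softmax (linForms c x i) k * c i k m := by
    simp only [Finset.mul_sum]
    rw [Finset.sum_comm]
    exact Finset.sum_congr rfl fun m _ => Finset.sum_congr rfl fun k _ => by ring
  have h2 : ∑ l, ∑ k, rowWeight s (linForms c x) l * softmax (linForms c x l) k *
        ∑ m, c' i j m * c l k m = ∑ m, c' i j m * ∑ l, ∑ k,
          rowWeight s (linForms c x) l * softmax (linForms c x l) k * c l k m := by
    simp only [Finset.mul_sum]
    rw [Finset.sum_comm (s := (Finset.univ : Finset κ))]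
    refine Finset.sum_congr rfl fun l _ => ?_
    rw [Finset.sum_comm (s := (Finset.univ : Finset κ))]
    exact Finset.sum_congr rfl fun k _ => Finset.sum_congr rfl fun m _ => by ring
  rw [h1, h2, Finset.mul_sum, Finset.mul_sum, ← Finset.sum_add_distrib, ← Finset.sum_sub_distrib,
    Finset.mul_sum, Finset.mul_sum]
  exact Finset.sum_congr rfl fun m _ => by ring

/-- Comparison of Sudakov–Fernique (`s = 1`) and Gordon (`s = -1`) type for two independent
Gaussian processes, given as linear images of one standard Gaussian vector: if their increments
agree inside rows and those of the second dominate between rows, then the expectation of `lseTwo s`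
is larger for the second. -/
theorem integral_lseTwo_linForms_le (s : ℝ) (a b : I → J → κ → ℝ)
    (horth : ∀ i j l k, ∑ m, a i j m * b l k m = 0)
    (hsame : ∀ i j k, ∑ m, (a i j m - a i k m) ^ 2 = ∑ m, (b i j m - b i k m) ^ 2)
    (hdiff : ∀ i j l k, ∑ m, (a i j m - a l k m) ^ 2 ≤ ∑ m, (b i j m - b l k m) ^ 2) :
    ∫ x, lseTwo s (linForms a x) ∂(stdGaussianPi κ)
      ≤ ∫ x, lseTwo s (linForms b x) ∂(stdGaussianPi κ) := by
  set c : ℝ → I → J → κ → ℝ := fun θ i j m => Real.cos θ * a i j m + Real.sin θ * b i j m with hc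
  set c' : ℝ → I → J → κ → ℝ := fun θ i j m => -Real.sin θ * a i j m + Real.cos θ * b i j m
    with hc'
  have hder : ∀ θ x i j, HasDerivAt (fun θ => linForms (c θ) x i j) (linForms (c' θ) x i j) θ := by
    intro θ x i j
    refine HasDerivAt.fun_sum fun m _ => HasDerivAt.mul_const ?_ _
    exact ((Real.hasDerivAt_cos θ).mul_const _).add ((Real.hasDerivAt_sin θ).mul_const _)
  have hderiv : ∀ θ, HasDerivAt (fun θ => ∫ x, lseTwo s (linForms (c θ) x) ∂(stdGaussianPi κ))
      (∫ x, ∑ i, ∑ j, s * (rowWeight s (linForms (c θ) x) i * softmax (linForms (c θ) x i) j)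
        * linForms (c' θ) x i j ∂(stdGaussianPi κ)) θ := by
    intro θ
    refine (hasDerivAt_integral_of_dominated_loc_of_deriv_le (s := Set.univ)
      (bound := fun x => ∑ i, ∑ j, |s| * ∑ m, (|a i j m| + |b i j m|) * |x m|)
      (F' := fun θ x => ∑ i, ∑ j, s * (rowWeight s (linForms (c θ) x) i *
        softmax (linForms (c θ) x i) j) * linForms (c' θ) x i j)
      Filter.univ_mem ?_ (integrable_lseTwo_linForms s _) ?_ ?_ ?_ ?_).2
    · exact Filter.Eventually.of_forall fun θ =>
        (integrable_lseTwo_linForms s _).aestronglyMeasurable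
    · refine (continuous_finsetSum _ fun i _ => continuous_finsetSum _ fun j _ =>
        (continuous_const.mul ((continuous_gradient_lseTwo s i j).comp
          (continuous_linForms (c θ)))).mul ?_).aestronglyMeasurable
      exact (continuous_apply j).comp ((continuous_apply i).comp (continuous_linForms (c' θ)))
    · refine Filter.Eventually.of_forall fun x θ _ => ?_
      refine (norm_sum_le _ _).trans (Finset.sum_le_sum fun i _ =>
        (norm_sum_le _ _).trans (Finset.sum_le_sum fun j _ => ?_))
      have hp := rowWeight_mul_softmax_mem s (linForms (c θ) x) i j
      rw [norm_mul, norm_mul, Real.norm_of_nonneg hp.1, Real.norm_eq_abs]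
      refine mul_le_mul (mul_le_of_le_one_right (abs_nonneg _) hp.2) ?_ (norm_nonneg _)
        (abs_nonneg _)
      refine (norm_sum_le _ _).trans (Finset.sum_le_sum fun m _ => ?_)
      rw [norm_mul]
      refine mul_le_mul_of_nonneg_right ?_ (norm_nonneg _)
      refine (norm_add_le _ _).trans (add_le_add ?_ ?_)
      · rw [norm_mul, norm_neg]
        exact mul_le_of_le_one_left (norm_nonneg _) (Real.abs_sin_le_one θ)
      · rw [norm_mul]
        exact mul_le_of_le_one_left (norm_nonneg _) (Real.abs_cos_le_one θ)
    · exact integrable_finsetSum _ fun i _ => integrable_finsetSum _ fun j _ =>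
        (integrable_finsetSum _ fun m _ =>
          (integrable_eval_stdGaussianPi m).abs.const_mul _).const_mul _
    · exact Filter.Eventually.of_forall fun x θ _ => hasDerivAt_lseTwo s (hder θ x)
  -- by orthogonality of `a` and `b` the mixed covariances drop out
  have hM : ∀ θ i j l k, ∑ m, c' θ i j m * c θ l k m =
      Real.sin θ * Real.cos θ * (∑ m, b i j m * b l k m - ∑ m, a i j m * a l k m) := by
    intro θ i j l k
    have : ∀ m, c' θ i j m * c θ l k m = Real.sin θ * Real.cos θ * (b i j m * b l k m
        - a i j m * a l k m) - Real.sin θ ^ 2 * (a i j m * b l k m)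
        + Real.cos θ ^ 2 * (a l k m * b i j m) := by
      intro m; simp only [hc, hc']; ring
    simp_rw [this, Finset.sum_add_distrib, Finset.sum_sub_distrib, ← Finset.mul_sum, horth,
      Finset.sum_sub_distrib]
    ring
  have hsq : ∀ (u v : κ → ℝ), ∑ m, (u m - v m) ^ 2 =
      ∑ m, u m * u m + ∑ m, v m * v m - 2 * ∑ m, u m * v m := by
    intro u v
    rw [Finset.mul_sum, ← Finset.sum_add_distrib, ← Finset.sum_sub_distrib]
    exact Finset.sum_congr rfl fun m _ => by ring
  simp only [hsq] at hsame hdiff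
  have hmono : MonotoneOn (fun θ => ∫ x, lseTwo s (linForms (c θ) x) ∂(stdGaussianPi κ))
      (Set.Icc 0 (Real.pi / 2)) := by
    refine monotoneOn_of_hasDerivWithinAt_nonneg (convex_Icc _ _)
      (fun θ _ => (hderiv θ).continuousAt.continuousWithinAt)
      (fun θ _ => (hderiv θ).hasDerivWithinAt) fun θ hθ => ?_
    rw [interior_Icc] at hθ
    have hsc : 0 ≤ Real.sin θ * Real.cos θ :=
      mul_nonneg (Real.sin_nonneg_of_nonneg_of_le_pi hθ.1.le (by linarith [hθ.2, Real.pi_pos]))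
        (Real.cos_nonneg_of_neg_pi_div_two_le_of_le (by linarith [hθ.1, Real.pi_pos]) hθ.2.le)
    refine integral_gradient_lseTwo_nonneg s (c θ) (c' θ) (fun i j k => ?_) fun i j l k => ?_
    · simp only [hM]
      linear_combination (-(Real.sin θ * Real.cos θ)) * hsame i j k
    · simp only [hM]
      have := mul_nonneg hsc (sub_nonneg.2 (hdiff i j l k))
      linarith
  have h0 := hmono (Set.left_mem_Icc.2 (by positivity)) (Set.right_mem_Icc.2 (by positivity))
    (show (0 : ℝ) ≤ Real.pi / 2 by positivity)
  simpa [hc] using! h0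

end Interpolation

/-! ### Laws of orthonormal Gaussian families -/

section Law
variable {Ω : Type*} [MeasurableSpace Ω] {P : Measure Ω}

/-- An orthonormal Gaussian family has the standard Gaussian law. -/
lemma IsOrthonormalGaussian.map_eq [IsProbabilityMeasure P] {ι : Type*} [Fintype ι]
    {ξ : ι → Ω → ℝ} (h : IsOrthonormalGaussian ξ P) :
    P.map (fun ω i => ξ i ω) = stdGaussianPi ι := by
  have hL : ∀ i, MemLp (ξ i) 2 P := fun i => (h.hasGaussianLaw.eval i).memLp_two
  have hcov : ∀ i j, i ≠ j → cov[ξ i, ξ j; P] = 0 := by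
    intro i j hij
    rw [covariance_eq_sub (hL i) (hL j), h.centered i, zero_mul, sub_zero]
    exact h.orthogonal i j hij
  have hind := h.hasGaussianLaw.iIndepFun_of_covariance_eq_zero hcov
  have hmeas : ∀ i, AEMeasurable (ξ i) P := fun i => (hL i).aemeasurable
  rw [(iIndepFun_iff_map_fun_eq_pi_map hmeas).1 hind]
  congr 1 with i : 1
  have hvar : Var[ξ i; P] = 1 := by
    rw [variance_eq_sub (hL i), h.centered i]
    simpa using h.unit i
  rw [(h.hasGaussianLaw.eval i).map_eq_gaussianReal, h.centered i, hvar, Real.toNNReal_one]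

lemma IsOrthonormalGaussian.aemeasurable {ι : Type*} [Fintype ι]
    {ξ : ι → Ω → ℝ} (h : IsOrthonormalGaussian ξ P) : AEMeasurable (fun ω i => ξ i ω) P :=
  h.hasGaussianLaw.aemeasurable

lemma IsOrthonormalGaussian.integrable {ι : Type*} [Fintype ι]
    {ξ : ι → Ω → ℝ} (h : IsOrthonormalGaussian ξ P) (i : ι) : Integrable (ξ i) P :=
  (h.hasGaussianLaw.eval i).integrable

/-- Concatenating independent standard Gaussian vectors gives a standard Gaussian vector. -/
lemma map_sumElim_eq_stdGaussianPi [IsProbabilityMeasure P] {ι κ : Type*} [Fintype ι] [Fintype κ]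
    {X : Ω → ι → ℝ} {Y : Ω → κ → ℝ} (hX : AEMeasurable X P) (hY : AEMeasurable Y P)
    (hXl : P.map X = stdGaussianPi ι) (hYl : P.map Y = stdGaussianPi κ) (h : IndepFun X Y P) :
    AEMeasurable (fun ω => (Sum.elim (X ω) (Y ω) : ι ⊕ κ → ℝ)) P ∧
      P.map (fun ω => (Sum.elim (X ω) (Y ω) : ι ⊕ κ → ℝ)) = stdGaussianPi (ι ⊕ κ) := by
  have hmp := measurePreserving_sumPiEquivProdPi_symm (X := fun _ : ι ⊕ κ => ℝ)
    (fun _ => gaussianReal 0 1)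
  have hprod := h.map_prod_eq_prod_map_map hX hY
  rw [hXl, hYl] at hprod
  have hfun : (fun ω => (Sum.elim (X ω) (Y ω) : ι ⊕ κ → ℝ)) =
      (MeasurableEquiv.sumPiEquivProdPi (fun _ : ι ⊕ κ => ℝ)).symm ∘ fun ω => (X ω, Y ω) := by
    ext ω m
    cases m <;> rfl
  rw [hfun]
  refine ⟨hmp.measurable.comp_aemeasurable (hX.prodMk hY), ?_⟩
  rw [← AEMeasurable.map_map_of_aemeasurable hmp.measurable.aemeasurable (hX.prodMk hY), hprod]
  exact hmp.map_eq

end Law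

/-! ### Increments of the two processes -/

section EuclideanIncrements
variable {ι κ : Type*} [Fintype ι] [Fintype κ]

lemma sum_sub_sq (u v : ι → ℝ) :
    ∑ i, (u i - v i) ^ 2 = ∑ i, u i ^ 2 + ∑ i, v i ^ 2 - 2 * ∑ i, u i * v i := by
  rw [Finset.mul_sum, ← Finset.sum_add_distrib, ← Finset.sum_sub_distrib]
  exact Finset.sum_congr rfl fun m _ => by ring

lemma sum_mul_sub_mul_sq (u u' : ι → ℝ) (v v' : κ → ℝ) :
    ∑ p : ι × κ, (u p.1 * v p.2 - u' p.1 * v' p.2) ^ 2 =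
      (∑ i, u i ^ 2) * (∑ k, v k ^ 2) + (∑ i, u' i ^ 2) * (∑ k, v' k ^ 2)
        - 2 * ((∑ i, u i * u' i) * ∑ k, v k * v' k) := by
  rw [sum_sub_sq]
  have h : ∑ p : ι × κ, u p.1 * v p.2 * (u' p.1 * v' p.2) =
      (∑ i, u i * u' i) * ∑ k, v k * v' k := by
    simp only [Fintype.sum_mul_sum, Fintype.sum_prod_type]
    exact Finset.sum_congr rfl fun i _ => Finset.sum_congr rfl fun k _ => by ring
  rw [h]
  simp only [Fintype.sum_mul_sum, Fintype.sum_prod_type, mul_pow]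

lemma sum_const_mul_sub_sq (r r' : ℝ) (v v' : κ → ℝ) :
    ∑ k, (r * v k - r' * v' k) ^ 2 = r ^ 2 * (∑ k, v k ^ 2) + r' ^ 2 * (∑ k, v' k ^ 2)
      - 2 * (r * r' * ∑ k, v k * v' k) := by
  rw [sum_sub_sq]
  have h : ∑ k, r * v k * (r' * v' k) = r * r' * ∑ k, v k * v' k := by
    rw [Finset.mul_sum]
    exact Finset.sum_congr rfl fun k _ => by ring
  rw [h]
  simp only [Finset.mul_sum, mul_pow]

/-- The comparison of increments: `u ⊗ v` is a distance from `u' ⊗ v'` at most that of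
`(|u| v, ε u)` from `(|u'| v', ε u')` as soon as `v` and `v'` have length at most `ε`. The
difference of the squared distances is
`ε² (|u| - |u'|)² + 2 (ε² - ⟨v, v'⟩) (|u| |u'| - ⟨u, u'⟩)`. -/
lemma sum_mul_sub_mul_sq_le (u u' : ι → ℝ) (v v' : κ → ℝ) {ε : ℝ}
    (hv : ∑ k, v k ^ 2 ≤ ε ^ 2) (hv' : ∑ k, v' k ^ 2 ≤ ε ^ 2) :
    ∑ p : ι × κ, (u p.1 * v p.2 - u' p.1 * v' p.2) ^ 2 ≤
      ∑ k, (√(∑ i, u i ^ 2) * v k - √(∑ i, u' i ^ 2) * v' k) ^ 2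
        + ∑ i, (ε * u i - ε * u' i) ^ 2 := by
  rw [sum_mul_sub_mul_sq, sum_const_mul_sub_sq, sum_const_mul_sub_sq]
  have h1 : ∑ i, u i * u' i ≤ √(∑ i, u i ^ 2) * √(∑ i, u' i ^ 2) :=
    Real.sum_mul_le_sqrt_mul_sqrt _ _ _
  have h2 : ∑ k, v k * v' k ≤ ε ^ 2 := by
    have := Finset.sum_nonneg fun k (_ : k ∈ Finset.univ) => sq_nonneg (v k - v' k)
    rw [sum_sub_sq] at this
    linarith
  have hu : √(∑ i, u i ^ 2) ^ 2 = ∑ i, u i ^ 2 :=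
    Real.sq_sqrt (Finset.sum_nonneg fun _ _ => sq_nonneg _)
  have hu' : √(∑ i, u' i ^ 2) ^ 2 = ∑ i, u' i ^ 2 :=
    Real.sq_sqrt (Finset.sum_nonneg fun _ _ => sq_nonneg _)
  have h3 := mul_nonneg (sub_nonneg.2 h2) (sub_nonneg.2 h1)
  have h4 := mul_nonneg (sq_nonneg ε) (sq_nonneg (√(∑ i, u i ^ 2) - √(∑ i, u' i ^ 2)))
  rw [hu, hu']
  rw [sub_sq, hu, hu'] at h4
  linarith

/-- Inside a row (`u = u'`) the two increments agree. -/
lemma sum_mul_sub_mul_sq_eq (u : ι → ℝ) (v v' : κ → ℝ) :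
    ∑ p : ι × κ, (u p.1 * v p.2 - u p.1 * v' p.2) ^ 2 =
      ∑ k, (√(∑ i, u i ^ 2) * v k - √(∑ i, u i ^ 2) * v' k) ^ 2 := by
  have hu : √(∑ i, u i ^ 2) ^ 2 = ∑ i, u i ^ 2 :=
    Real.sq_sqrt (Finset.sum_nonneg fun _ _ => sq_nonneg _)
  rw [sum_mul_sub_mul_sq, sum_const_mul_sub_sq, ← sq, hu]
  simp only [← sq]

end EuclideanIncrements

/-- The comparison for finitely many vectors `uₓ` and `vᵧ`: the process `⟨G uₓ, vᵧ⟩` against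
`|uₓ| ⟨h, vᵧ⟩ + ε ⟨g, uₓ⟩`, at inverse temperature `β`. -/
theorem integral_lseTwo_bilinear_le {Ω : Type*} [MeasurableSpace Ω] {P : Measure Ω}
    [IsProbabilityMeasure P] {ι κ I J : Type*} [Fintype ι] [Fintype κ] [Fintype I] [Fintype J]
    [Nonempty I] [Nonempty J] {G : ι → κ → Ω → ℝ} {h : κ → Ω → ℝ} {g : ι → Ω → ℝ}
    (hG : IsOrthonormalGaussian (fun p : ι × κ => G p.1 p.2) P)
    (hh : IsOrthonormalGaussian h P) (hg : IsOrthonormalGaussian g P)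
    (hind₁ : IndepFun (fun ω (p : ι × κ) => G p.1 p.2 ω)
      (fun ω => ((fun k => h k ω), (fun i => g i ω))) P)
    (hind₂ : IndepFun (fun ω k => h k ω) (fun ω i => g i ω) P)
    (s β ε : ℝ) (u : I → ι → ℝ) (v : J → κ → ℝ) (hv : ∀ y, ∑ k, v y k ^ 2 ≤ ε ^ 2) :
    Integrable (fun ω => lseTwo s fun x y => β * ∑ i, ∑ k, G i k ω * (u x i * v y k)) P ∧
    Integrable (fun ω => lseTwo s fun x y =>
      β * (√(∑ i, u x i ^ 2) * (∑ k, h k ω * v y k) + ε * ∑ i, g i ω * u x i)) P ∧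
    ∫ ω, lseTwo s (fun x y => β * ∑ i, ∑ k, G i k ω * (u x i * v y k)) ∂P ≤
      ∫ ω, lseTwo s (fun x y =>
        β * (√(∑ i, u x i ^ 2) * (∑ k, h k ω * v y k) + ε * ∑ i, g i ω * u x i)) ∂P := by
  obtain ⟨hm1, hl1⟩ := map_sumElim_eq_stdGaussianPi hh.aemeasurable hg.aemeasurable hh.map_eq
    hg.map_eq hind₂
  have hind : IndepFun (fun ω (p : ι × κ) => G p.1 p.2 ω)
      (fun ω => (Sum.elim (fun k => h k ω) (fun i => g i ω) : κ ⊕ ι → ℝ)) P :=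
    hind₁.comp measurable_id
      (MeasurableEquiv.sumPiEquivProdPi (fun _ : κ ⊕ ι => ℝ)).symm.measurable
  obtain ⟨hm, hl⟩ := map_sumElim_eq_stdGaussianPi hG.aemeasurable hm1 hG.map_eq hl1 hind
  set U : Ω → (ι × κ) ⊕ (κ ⊕ ι) → ℝ := fun ω =>
    Sum.elim (fun p => G p.1 p.2 ω) (Sum.elim (fun k => h k ω) (fun i => g i ω)) with hU
  set a : I → J → (ι × κ) ⊕ (κ ⊕ ι) → ℝ := fun x y =>
    Sum.elim (fun p => β * (u x p.1 * v y p.2)) (fun _ => 0) with ha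
  set b : I → J → (ι × κ) ⊕ (κ ⊕ ι) → ℝ := fun x y =>
    Sum.elim (fun _ => 0) (Sum.elim (fun k => β * (√(∑ i, u x i ^ 2) * v y k))
      (fun i => β * (ε * u x i))) with hb
  have haU : ∀ ω, linForms a (U ω) =
      fun x y => β * ∑ i, ∑ k, G i k ω * (u x i * v y k) := by
    intro ω
    ext x y
    simp only [linForms, ha, hU, Fintype.sum_sum_type, Sum.elim_inl, Sum.elim_inr, zero_mul,
      Finset.sum_const_zero, add_zero, Fintype.sum_prod_type, Finset.mul_sum]
    exact Finset.sum_congr rfl fun i _ => Finset.sum_congr rfl fun k _ => by ring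
  have hbU : ∀ ω, linForms b (U ω) = fun x y =>
      β * (√(∑ i, u x i ^ 2) * (∑ k, h k ω * v y k) + ε * ∑ i, g i ω * u x i) := by
    intro ω
    ext x y
    simp only [linForms, hb, hU, Fintype.sum_sum_type, Sum.elim_inl, Sum.elim_inr, zero_mul,
      Finset.sum_const_zero, zero_add, Finset.mul_sum, mul_add]
    congr 1
    · exact Finset.sum_congr rfl fun k _ => by ring
    · exact Finset.sum_congr rfl fun i _ => by ring
  have hia := integrable_lseTwo_linForms s a
  have hib := integrable_lseTwo_linForms s b
  have key := integral_lseTwo_linForms_le s a b (fun x y x' y' => by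
      simp [ha, hb, Fintype.sum_sum_type]) (fun x y y' => ?_) (fun x y x' y' => ?_)
  · rw [← hl] at hia hib key
    rw [integral_map hm hia.aestronglyMeasurable, integral_map hm hib.aestronglyMeasurable] at key
    have hia' := hia.comp_aemeasurable hm
    have hib' := hib.comp_aemeasurable hm
    simp only [Function.comp_def] at hia' hib'
    refine ⟨?_, ?_, ?_⟩
    · simpa only [← haU] using hia'
    · simpa only [← hbU] using hib'
    · simpa only [← haU, ← hbU] using key
  · have := sum_mul_sub_mul_sq_eq (u x) (v y) (v y')
    simp only [ha, hb, Fintype.sum_sum_type, Sum.elim_inl, Sum.elim_inr, ← mul_sub, sub_self,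
      mul_pow, ← Finset.mul_sum] at this ⊢
    simp [this]
  · have := mul_le_mul_of_nonneg_left
      (sum_mul_sub_mul_sq_le (u x) (u x') (v y) (v y') (hv y) (hv y')) (sq_nonneg β)
    simp only [ha, hb, Fintype.sum_sum_type, Sum.elim_inl, Sum.elim_inr, ← mul_sub β, sub_self,
      mul_pow β, ← Finset.mul_sum, mul_add] at this ⊢
    simpa using this

/-! ### Limits and finite nets -/

section Limits

lemma nonpos_of_forall_pos_mul_le {x c : ℝ} (h : ∀ β : ℝ, 0 < β → β * x ≤ c) : x ≤ 0 := by
  by_contra! hx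
  have h1 := h ((|c| + 1) / x) (by positivity)
  rw [div_mul_cancel₀ _ hx.ne'] at h1
  linarith [le_abs_self c]

/-- The limit of infinite inverse temperature followed by the limit of vanishing mesh. -/
lemma le_of_forall_mesh_temperature {A B W : ℝ}
    (h : ∀ δ : ℝ, 0 < δ → ∃ c, ∀ β : ℝ, 0 < β → β * (A - δ * W) ≤ β * B + c) : A ≤ B := by
  have h1 : ∀ δ : ℝ, 0 < δ → A - δ * W ≤ B := fun δ hδ => by
    obtain ⟨c, hc⟩ := h δ hδ
    have := nonpos_of_forall_pos_mul_le (x := A - δ * W - B) (c := c) fun β hβ => by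
      have := hc β hβ
      rw [mul_sub]
      linarith
    linarith
  refine le_of_forall_pos_le_add fun η hη => ?_
  have hW : 0 < |W| + 1 := by positivity
  have h2 := h1 (η / (|W| + 1)) (by positivity)
  have h3 : η / (|W| + 1) * W ≤ η := by
    rw [div_mul_eq_mul_div, div_le_iff₀ hW]
    exact mul_le_mul_of_nonneg_left (by linarith [le_abs_self W]) hη.le
  linarith

/-- A set on which finitely many real functions are bounded has a finite net with respect to
them. -/
lemma exists_finset_net {X ι : Type*} [Fintype ι] (S : Set X) (φ : X → ι → ℝ) {C : ι → ℝ}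
    (hC : ∀ x ∈ S, ∀ i, |φ x i| ≤ C i) {δ : ℝ} (hδ : 0 < δ) :
    ∃ t : Finset X, (∀ x ∈ t, x ∈ S) ∧ ∀ x ∈ S, ∃ x' ∈ t, ∀ i, |φ x i - φ x' i| ≤ δ := by
  classical
  have hb : TotallyBounded (φ '' S) :=
    (isCompact_Icc (a := fun i => -C i) (b := C)).totallyBounded.subset (by
      rintro _ ⟨x, hx, rfl⟩
      exact ⟨fun i => (abs_le.1 (hC x hx i)).1, fun i => (abs_le.1 (hC x hx i)).2⟩)
  obtain ⟨t, hts, htf, hcov⟩ := Metric.finite_approx_of_totallyBounded hb δ hδ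
  lift t to Finset (ι → ℝ) using htf
  obtain ⟨t', htS, rfl⟩ := Finset.subset_set_image_iff.1 hts
  refine ⟨t', fun x hx => htS hx, fun x hx => ?_⟩
  obtain ⟨z, hz, hxz⟩ := Set.mem_iUnion₂.1 (hcov ⟨x, hx, rfl⟩)
  obtain ⟨x', hx', rfl⟩ := Finset.mem_image.1 (Finset.mem_coe.1 hz)
  refine ⟨x', hx', fun i => ?_⟩
  rw [← Real.dist_eq]
  exact (dist_le_pi_dist _ _ i).trans (Metric.mem_ball.1 hxz).le

end Limits

/-! ### Operators on the unit sphere -/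

section Operators
variable {E F : Type*} [NormedAddCommGroup E] [NormedSpace ℝ E] [NormedAddCommGroup F]
  [NormedSpace ℝ F]

lemma sphereMin_le (T : E →L[ℝ] F) {x : E} (hx : ‖x‖ = 1) : sphereMin T ≤ ‖T x‖ :=
  csInf_le ⟨0, by rintro _ ⟨y, -, rfl⟩; exact norm_nonneg _⟩ ⟨x, hx, rfl⟩

lemma le_sphereMax (T : E →L[ℝ] F) {x : E} (hx : ‖x‖ = 1) : ‖T x‖ ≤ sphereMax T :=
  le_csSup ⟨‖T‖, by rintro _ ⟨y, hy, rfl⟩; exact T.unit_le_opNorm y hy.le⟩ ⟨x, hx, rfl⟩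

lemma le_sphereMin [Nontrivial E] (T : E →L[ℝ] F) {r : ℝ} (h : ∀ x, ‖x‖ = 1 → r ≤ ‖T x‖) :
    r ≤ sphereMin T := by
  obtain ⟨x, hx⟩ := exists_norm_eq E zero_le_one
  exact le_csInf ⟨_, x, hx, rfl⟩ (by rintro _ ⟨y, hy, rfl⟩; exact h y hy)

lemma sphereMax_le [Nontrivial E] (T : E →L[ℝ] F) {r : ℝ} (h : ∀ x, ‖x‖ = 1 → ‖T x‖ ≤ r) :
    sphereMax T ≤ r := by
  obtain ⟨x, hx⟩ := exists_norm_eq E zero_le_one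
  exact csSup_le ⟨_, x, hx, rfl⟩ (by rintro _ ⟨y, hy, rfl⟩; exact h y hy)

lemma sphereMin_nonneg [Nontrivial E] (T : E →L[ℝ] F) : 0 ≤ sphereMin T :=
  le_sphereMin T fun _ _ => norm_nonneg _

lemma sphereMin_le_sphereMax [Nontrivial E] (T : E →L[ℝ] F) : sphereMin T ≤ sphereMax T := by
  obtain ⟨x, hx⟩ := exists_norm_eq E zero_le_one
  exact (sphereMin_le T hx).trans (le_sphereMax T hx)

lemma sphereMax_le_opNorm [Nontrivial E] (T : E →L[ℝ] F) : sphereMax T ≤ ‖T‖ :=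
  sphereMax_le T fun x hx => T.unit_le_opNorm x hx.le

lemma norm_apply_le_add_dist (T T' : E →L[ℝ] F) {x : E} (hx : ‖x‖ = 1) :
    ‖T x‖ ≤ ‖T' x‖ + dist T T' := by
  have h1 : ‖(T - T') x‖ ≤ ‖T - T'‖ := (T - T').unit_le_opNorm x hx.le
  have h2 := norm_add_le (T' x) ((T - T') x)
  rw [dist_eq_norm]
  simp only [sub_apply, add_sub_cancel] at h1 h2
  linarith

lemma continuous_sphereMin [Nontrivial E] : Continuous (sphereMin : (E →L[ℝ] F) → ℝ) :=
  (LipschitzWith.of_le_add fun T T' => by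
    have := le_sphereMin T' (r := sphereMin T - dist T T') fun x hx => by
      linarith [sphereMin_le T hx, norm_apply_le_add_dist T T' hx]
    linarith : LipschitzWith 1 (sphereMin : (E →L[ℝ] F) → ℝ)).continuous

lemma continuous_sphereMax [Nontrivial E] : Continuous (sphereMax : (E →L[ℝ] F) → ℝ) :=
  (LipschitzWith.of_le_add fun T T' => sphereMax_le T fun x hx => by
    linarith [le_sphereMax T' hx, norm_apply_le_add_dist T T' hx] :
    LipschitzWith 1 (sphereMax : (E →L[ℝ] F) → ℝ)).continuous

lemma integrable_sphereMin_sphereMax [Nontrivial E] {Ω : Type*} [MeasurableSpace Ω]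
    {P : Measure Ω} {T : Ω → E →L[ℝ] F} (hT : Integrable T P) :
    Integrable (fun ω => sphereMin (T ω)) P ∧ Integrable (fun ω => sphereMax (T ω)) P := by
  constructor
  · refine hT.norm.mono' (continuous_sphereMin.comp_aestronglyMeasurable hT.1)
      (Filter.Eventually.of_forall fun ω => ?_)
    rw [Real.norm_of_nonneg (sphereMin_nonneg _)]
    exact (sphereMin_le_sphereMax _).trans (sphereMax_le_opNorm _)
  · refine hT.norm.mono' (continuous_sphereMax.comp_aestronglyMeasurable hT.1)
      (Filter.Eventually.of_forall fun ω => ?_)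
    rw [Real.norm_of_nonneg ((sphereMin_nonneg _).trans (sphereMin_le_sphereMax _))]
    exact sphereMax_le_opNorm _

variable {n d : ℕ} (xs : Fin n → StrongDual ℝ E) (f : Fin d → F)

lemma le_epsTwoDual {x : E} (hx : ‖x‖ ≤ 1) : √(∑ i, (xs i x) ^ 2) ≤ epsTwoDual xs := by
  refine le_csSup ⟨√(∑ i, ‖xs i‖ ^ 2), ?_⟩ ⟨x, hx, rfl⟩
  rintro _ ⟨y, hy, rfl⟩
  refine Real.sqrt_le_sqrt (Finset.sum_le_sum fun i _ => ?_)
  rw [← sq_abs]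
  exact pow_le_pow_left₀ (abs_nonneg _) ((xs i).unit_le_opNorm y hy) 2

lemma le_epsTwo {y : StrongDual ℝ F} (hy : ‖y‖ ≤ 1) : √(∑ k, (y (f k)) ^ 2) ≤ epsTwo f := by
  refine le_csSup ⟨√(∑ k, ‖f k‖ ^ 2), ?_⟩ ⟨y, hy, rfl⟩
  rintro _ ⟨z, hz, rfl⟩
  refine Real.sqrt_le_sqrt (Finset.sum_le_sum fun k _ => ?_)
  rw [← sq_abs]
  exact pow_le_pow_left₀ (abs_nonneg _) (z.le_of_opNorm_le_of_le hz le_rfl |>.trans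
    (one_mul _).le) 2

lemma epsTwo_nonneg : 0 ≤ epsTwo f :=
  (Real.sqrt_nonneg _).trans (le_epsTwo f (y := 0) (by simp))

lemma sum_sq_le_epsTwo_sq {y : StrongDual ℝ F} (hy : ‖y‖ ≤ 1) :
    ∑ k, (y (f k)) ^ 2 ≤ epsTwo f ^ 2 :=
  (Real.sqrt_le_left (epsTwo_nonneg f)).1 (le_epsTwo f hy)

lemma apply_tensorOperator (a : Fin n → Fin d → ℝ) (x : E) (y : StrongDual ℝ F) :
    y (tensorOperator xs f a x) = ∑ i, ∑ k, a i k * (xs i x * y (f k)) := by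
  simp [tensorOperator, map_sum]

/-- The Lipschitz constant of `(x, y) ↦ y (T x)`, for `T = tensorOperator xs f a`, with respect to
the values of the functionals `xs` at `x` and of `y` at the vectors `f`. -/
noncomputable def tensorModulus (a : Fin n → Fin d → ℝ) : ℝ :=
  ∑ i, ∑ k, |a i k| * (‖xs i‖ + ‖f k‖)

lemma apply_tensorOperator_le (a : Fin n → Fin d → ℝ) {x x' : E} {y y' : StrongDual ℝ F} {δ : ℝ}
    (hx : ‖x‖ = 1) (hy' : ‖y'‖ ≤ 1) (hxx : ∀ i, |xs i x - xs i x'| ≤ δ)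
    (hyy : ∀ k, |y (f k) - y' (f k)| ≤ δ) :
    y (tensorOperator xs f a x) ≤ y' (tensorOperator xs f a x') + δ * tensorModulus xs f a := by
  rw [← sub_le_iff_le_add', apply_tensorOperator, apply_tensorOperator, tensorModulus,
    ← Finset.sum_sub_distrib, Finset.mul_sum]
  refine Finset.sum_le_sum fun i _ => ?_
  rw [← Finset.sum_sub_distrib, Finset.mul_sum]
  refine Finset.sum_le_sum fun k _ => ?_
  have h1 : |xs i x * (y (f k) - y' (f k))| ≤ ‖xs i‖ * δ := by
    rw [abs_mul]
    exact mul_le_mul ((xs i).unit_le_opNorm x hx.le) (hyy k) (abs_nonneg _) (norm_nonneg _)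
  have h2 : |y' (f k) * (xs i x - xs i x')| ≤ ‖f k‖ * δ := by
    rw [abs_mul]
    exact mul_le_mul ((y'.le_of_opNorm_le_of_le hy' le_rfl).trans (one_mul _).le) (hxx i)
      (abs_nonneg _) (norm_nonneg _)
  have h3 : |xs i x * y (f k) - xs i x' * y' (f k)| ≤ ‖xs i‖ * δ + ‖f k‖ * δ := by
    have := (abs_add_le (xs i x * (y (f k) - y' (f k))) (y' (f k) * (xs i x - xs i x'))).trans
      (add_le_add h1 h2)
    convert! this using 2
    ring
  calc a i k * (xs i x * y (f k)) - a i k * (xs i x' * y' (f k))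
      ≤ |a i k * (xs i x * y (f k) - xs i x' * y' (f k))| := by
        rw [← mul_sub]; exact le_abs_self _
    _ ≤ |a i k| * (‖xs i‖ * δ + ‖f k‖ * δ) := by
        rw [abs_mul]; exact mul_le_mul_of_nonneg_left h3 (abs_nonneg _)
    _ = δ * (|a i k| * (‖xs i‖ + ‖f k‖)) := by ring

lemma norm_tensorOperator_le (a : Fin n → Fin d → ℝ) {x x' : E} {δ : ℝ} (hδ : 0 ≤ δ)
    (hx : ‖x‖ = 1) (hxx : ∀ i, |xs i x - xs i x'| ≤ δ) :
    ‖tensorOperator xs f a x‖ ≤ ‖tensorOperator xs f a x'‖ + δ * tensorModulus xs f a := by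
  obtain ⟨y, hy, hy2⟩ := exists_dual_vector'' ℝ (tensorOperator xs f a x)
  have h1 := apply_tensorOperator_le xs f a (y := y) hx hy hxx (fun _ => by simpa using hδ)
  have h2 : y (tensorOperator xs f a x') ≤ ‖tensorOperator xs f a x'‖ :=
    (le_abs_self _).trans ((y.le_of_opNorm_le_of_le hy le_rfl).trans (one_mul _).le)
  simp only [RCLike.ofReal_real_eq_id, id_eq] at hy2
  linarith

lemma apply_sum_smul_le_norm (c : Fin d → ℝ) {y : StrongDual ℝ F} (hy : ‖y‖ ≤ 1) :
    ∑ k, c k * y (f k) ≤ ‖∑ k, c k • f k‖ := by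
  have h := (y.le_of_opNorm_le_of_le hy (le_refl ‖∑ k, c k • f k‖)).trans (one_mul _).le
  simp only [map_sum, map_smul, smul_eq_mul] at h
  exact (le_abs_self _).trans h

lemma abs_sum_mul_apply_le_norm (c : Fin n → ℝ) {x : E} (hx : ‖x‖ = 1) :
    |∑ i, c i * xs i x| ≤ ‖∑ i, c i • xs i‖ := by
  have h := (∑ i, c i • xs i).unit_le_opNorm x hx.le
  simpa [sum_apply] using h

/-- A finite set of points of the unit sphere of `E`, and one of functionals in the unit ball of the
dual of `F`, that are `δ`-dense as seen by the functionals `xs` and the vectors `f`. -/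
structure IsMesh (δ : ℝ) (t : Finset E) (t' : Finset (StrongDual ℝ F)) : Prop where
  norm_eq : ∀ x ∈ t, ‖x‖ = 1
  norm_le : ∀ y ∈ t', ‖y‖ ≤ 1
  exists_near : ∀ x, ‖x‖ = 1 → ∃ x' ∈ t, ∀ i, |xs i x - xs i x'| ≤ δ
  exists_near_dual : ∀ y : StrongDual ℝ F, ‖y‖ ≤ 1 → ∃ y' ∈ t', ∀ k, |y (f k) - y' (f k)| ≤ δ

lemma exists_isMesh {δ : ℝ} (hδ : 0 < δ) : ∃ t t', IsMesh xs f δ t t' := by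
  obtain ⟨t, ht1, ht2⟩ := exists_finset_net {x : E | ‖x‖ = 1} (fun x i => xs i x)
    (C := fun i => ‖xs i‖) (fun x hx i => (xs i).unit_le_opNorm x (le_of_eq hx)) hδ
  obtain ⟨t', ht1', ht2'⟩ := exists_finset_net {y : StrongDual ℝ F | ‖y‖ ≤ 1}
    (fun y k => y (f k)) (C := fun k => ‖f k‖)
    (fun y hy k => (y.le_of_opNorm_le_of_le hy le_rfl).trans (one_mul _).le) hδ
  exact ⟨t, t', ht1, ht1', ht2, ht2'⟩

variable {xs f}

lemma IsMesh.nonempty [Nontrivial E] {δ : ℝ} {t : Finset E} {t' : Finset (StrongDual ℝ F)}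
    (h : IsMesh xs f δ t t') : Nonempty t ∧ Nonempty t' := by
  obtain ⟨x, hx⟩ := exists_norm_eq E zero_le_one
  obtain ⟨x', hx', -⟩ := h.exists_near x hx
  obtain ⟨y', hy', -⟩ := h.exists_near_dual 0 (by simp)
  exact ⟨⟨x', hx'⟩, ⟨y', hy'⟩⟩

end Operators

/-! ### Chevet's upper bound and Gordon's lower bound -/

section GordonChevet
variable {Ω : Type*} [MeasurableSpace Ω] {P : Measure Ω} [IsProbabilityMeasure P]
  {E : Type*} [NormedAddCommGroup E] [NormedSpace ℝ E] [Nontrivial E]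
  {F : Type*} [NormedAddCommGroup F] [NormedSpace ℝ F]
  {n d : ℕ} (xs : Fin n → StrongDual ℝ E) (f : Fin d → F)
  {G : Fin n → Fin d → Ω → ℝ} {h : Fin d → Ω → ℝ} {g : Fin n → Ω → ℝ}

lemma integral_affine_two {X Y : Ω → ℝ} (hX : Integrable X P) (hY : Integrable Y P) (p q c : ℝ) :
    Integrable (fun ω => p * X ω + q * Y ω + c) P ∧
      ∫ ω, (p * X ω + q * Y ω + c) ∂P = p * (∫ ω, X ω ∂P) + q * (∫ ω, Y ω ∂P) + c := by
  have h1 : Integrable (fun ω => p * X ω + q * Y ω) P := (hX.const_mul p).add (hY.const_mul q)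
  refine ⟨h1.add (integrable_const c), ?_⟩
  rw [integral_add h1 (integrable_const c), integral_add (hX.const_mul p) (hY.const_mul q),
    integral_const_mul, integral_const_mul, integral_const, probReal_univ, one_smul]

lemma integral_affine_three {X Y Z : Ω → ℝ} (hX : Integrable X P) (hY : Integrable Y P)
    (hZ : Integrable Z P) (p q r c : ℝ) :
    Integrable (fun ω => p * X ω + q * Y ω + r * Z ω + c) P ∧
      ∫ ω, (p * X ω + q * Y ω + r * Z ω + c) ∂P =
        p * (∫ ω, X ω ∂P) + q * (∫ ω, Y ω ∂P) + r * (∫ ω, Z ω ∂P) + c := by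
  have h1 : Integrable (fun ω => p * X ω + q * Y ω) P := (hX.const_mul p).add (hY.const_mul q)
  obtain ⟨h2, h3⟩ := integral_affine_two h1 hZ 1 r c
  simp only [one_mul] at h2 h3
  refine ⟨h2, ?_⟩
  rw [h3, integral_add (hX.const_mul p) (hY.const_mul q), integral_const_mul, integral_const_mul]

omit [IsProbabilityMeasure P] in
lemma IsOrthonormalGaussian.integrable_norm_sum_smul {ι : Type*} [Fintype ι] {ξ : ι → Ω → ℝ}
    (hξ : IsOrthonormalGaussian ξ P) (v : ι → F) :
    Integrable (fun ω => ‖∑ k, ξ k ω • v k‖) P :=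
  (integrable_finsetSum _ fun k _ => (hξ.integrable k).smul_const (v k)).norm

omit [IsProbabilityMeasure P] in
lemma integrable_sum_sum_smul {ι κ V : Type*} [Fintype ι] [Fintype κ] [NormedAddCommGroup V]
    [NormedSpace ℝ V] {ξ : ι → κ → Ω → ℝ} (hξ : ∀ i k, Integrable (ξ i k) P) (v : ι → κ → V) :
    Integrable (fun ω => ∑ i, ∑ k, ξ i k ω • v i k) P :=
  integrable_finsetSum _ fun i _ => integrable_finsetSum _ fun k _ => (hξ i k).smul_const (v i k)

omit [IsProbabilityMeasure P] [Nontrivial E] in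
lemma integrable_tensorOperator
    (hG : IsOrthonormalGaussian (fun p : Fin n × Fin d => G p.1 p.2) P) :
    Integrable (fun ω => tensorOperator xs f (fun i k => G i k ω)) P :=
  integrable_sum_sum_smul (fun i k => hG.integrable (i, k)) fun i k => (xs i).smulRight (f k)

omit [IsProbabilityMeasure P] [Nontrivial E] [NormedSpace ℝ F] in
lemma integrable_tensorModulus
    (hG : IsOrthonormalGaussian (fun p : Fin n × Fin d => G p.1 p.2) P) :
    Integrable (fun ω => tensorModulus xs f (fun i k => G i k ω)) P :=
  integrable_finsetSum _ fun i _ => integrable_finsetSum _ fun k _ =>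
    (hG.integrable (i, k)).abs.mul_const _

/-- Chevet's inequality: the comparison with `s = 1`. -/
theorem integral_sphereMax_tensorOperator_le
    (hG : IsOrthonormalGaussian (fun p : Fin n × Fin d => G p.1 p.2) P)
    (hh : IsOrthonormalGaussian h P) (hg : IsOrthonormalGaussian g P)
    (hind₁ : IndepFun (fun ω (p : Fin n × Fin d) => G p.1 p.2 ω)
      (fun ω => ((fun k => h k ω), (fun i => g i ω))) P)
    (hind₂ : IndepFun (fun ω k => h k ω) (fun ω i => g i ω) P) :
    ∫ ω, sphereMax (tensorOperator xs f (fun i k => G i k ω)) ∂P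
      ≤ epsTwoDual xs * (∫ ω, ‖∑ k, h k ω • f k‖ ∂P)
        + epsTwo f * (∫ ω, ‖∑ i, g i ω • xs i‖ ∂P) := by
  have hiT := (integrable_sphereMin_sphereMax (integrable_tensorOperator xs f hG)).2
  have hiW := integrable_tensorModulus xs f hG
  have hih := hh.integrable_norm_sum_smul f
  have hig := hg.integrable_norm_sum_smul xs
  refine le_of_forall_mesh_temperature
    (W := ∫ ω, tensorModulus xs f (fun i k => G i k ω) ∂P) fun δ hδ => ?_
  obtain ⟨t, t', hm⟩ := exists_isMesh xs f hδ
  obtain ⟨_, _⟩ := hm.nonempty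
  refine ⟨Real.log (Fintype.card t') + Real.log (Fintype.card t), fun β hβ => ?_⟩
  obtain ⟨hia, hib, hab⟩ := integral_lseTwo_bilinear_le hG hh hg hind₁ hind₂ 1 β (epsTwo f)
    (fun (x : t) i => xs i x) (fun (y : t') k => (y : StrongDual ℝ F) (f k))
    (fun y => sum_sq_le_epsTwo_sq f (hm.norm_le y y.2))
  obtain ⟨hi1, he1⟩ := integral_affine_two hiT hiW β (-(β * δ)) 0
  obtain ⟨hi2, he2⟩ := integral_affine_two hih hig (β * epsTwoDual xs) (β * epsTwo f)
    (Real.log (Fintype.card t') + Real.log (Fintype.card t))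
  have hlower := integral_mono hi1 hia fun ω => by
    -- every `‖T x‖` is reached, up to the mesh error, at some entry of the matrix
    set A := lseTwo 1 (fun (x : t) (y : t') =>
        β * ∑ i, ∑ k, G i k ω * (xs i x * (y : StrongDual ℝ F) (f k))) with hA
    have hmax : sphereMax (tensorOperator xs f (fun i k => G i k ω)) ≤
        A / β + δ * tensorModulus xs f (fun i k => G i k ω) := by
      refine sphereMax_le _ fun x hx => ?_
      obtain ⟨y, hy, hy2⟩ := exists_dual_vector'' ℝ
        (tensorOperator xs f (fun i k => G i k ω) x)
      simp only [RCLike.ofReal_real_eq_id, id_eq] at hy2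
      obtain ⟨x', hx', hxx⟩ := hm.exists_near x hx
      obtain ⟨y', hy', hyy⟩ := hm.exists_near_dual y hy
      have h1 := apply_tensorOperator_le xs f (fun i k => G i k ω) hx (hm.norm_le y' hy') hxx hyy
      rw [hy2, apply_tensorOperator] at h1
      refine h1.trans (add_le_add ?_ le_rfl)
      rw [le_div_iff₀' hβ, hA, lseTwo]
      refine le_trans ?_ (le_lse _ (⟨x', hx'⟩ : t))
      rw [one_mul]
      exact le_lse (fun y : t' => β * ∑ i, ∑ k, G i k ω * (xs i x' * (y : StrongDual ℝ F) (f k)))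
        ⟨y', hy'⟩
    rw [← sub_le_iff_le_add, le_div_iff₀' hβ] at hmax
    linarith
  have hupper := integral_mono hib hi2 fun ω => by
    -- pointwise, every entry of the dominating matrix is at most the right-hand side
    have h1 : lseTwo 1 (fun (x : t) (y : t') =>
        β * (√(∑ i, (xs i x) ^ 2) * (∑ k, h k ω * (y : StrongDual ℝ F) (f k))
          + epsTwo f * ∑ i, g i ω * xs i x)) ≤
        β * (epsTwoDual xs * ‖∑ k, h k ω • f k‖ + epsTwo f * ‖∑ i, g i ω • xs i‖)
          + Real.log (Fintype.card t') + Real.log (Fintype.card t) := by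
      refine lse_le fun x => ?_
      rw [one_mul]
      refine lse_le fun y => mul_le_mul_of_nonneg_left (add_le_add ?_ ?_) hβ.le
      · exact (mul_le_mul_of_nonneg_left (apply_sum_smul_le_norm f _ (hm.norm_le y y.2))
          (Real.sqrt_nonneg _)).trans (mul_le_mul_of_nonneg_right
            (le_epsTwoDual xs (hm.norm_eq x x.2).le) (norm_nonneg _))
      · exact mul_le_mul_of_nonneg_left ((le_abs_self _).trans
          (abs_sum_mul_apply_le_norm xs _ (hm.norm_eq x x.2))) (epsTwo_nonneg f)
    refine h1.trans (le_of_eq ?_)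
    ring
  have key := hlower.trans (hab.trans hupper)
  rw [he1, he2] at key
  linarith

/-- Gordon's inequality: the comparison with `s = -1`. -/
theorem le_integral_sphereMin_tensorOperator
    (hG : IsOrthonormalGaussian (fun p : Fin n × Fin d => G p.1 p.2) P)
    (hh : IsOrthonormalGaussian h P) (hg : IsOrthonormalGaussian g P)
    (hind₁ : IndepFun (fun ω (p : Fin n × Fin d) => G p.1 p.2 ω)
      (fun ω => ((fun k => h k ω), (fun i => g i ω))) P)
    (hind₂ : IndepFun (fun ω k => h k ω) (fun ω i => g i ω) P) :
    sInf {r : ℝ | ∃ x : E, ‖x‖ = 1 ∧ r = √(∑ i, (xs i x) ^ 2)} *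
          (∫ ω, ‖∑ k, h k ω • f k‖ ∂P)
        - epsTwo f * (∫ ω, ‖∑ i, g i ω • xs i‖ ∂P)
      ≤ ∫ ω, sphereMin (tensorOperator xs f (fun i k => G i k ω)) ∂P := by
  set lo : ℝ := sInf {r : ℝ | ∃ x : E, ‖x‖ = 1 ∧ r = √(∑ i, (xs i x) ^ 2)} with hlo
  have hlo_le : ∀ x : E, ‖x‖ = 1 → lo ≤ √(∑ i, (xs i x) ^ 2) := fun x hx =>
    csInf_le ⟨0, by rintro _ ⟨y, -, rfl⟩; exact Real.sqrt_nonneg _⟩ ⟨x, hx, rfl⟩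
  have hiT := (integrable_sphereMin_sphereMax (integrable_tensorOperator xs f hG)).1
  have hiW := integrable_tensorModulus xs f hG
  have hih := hh.integrable_norm_sum_smul f
  have hig := hg.integrable_norm_sum_smul xs
  have hiV : Integrable (fun ω => ∑ k, |h k ω|) P :=
    integrable_finsetSum _ fun k _ => (hh.integrable k).abs
  refine le_of_forall_mesh_temperature
    (W := (∫ ω, tensorModulus xs f (fun i k => G i k ω) ∂P)
      + epsTwoDual xs * ∫ ω, ∑ k, |h k ω| ∂P) fun δ hδ => ?_
  obtain ⟨t, t', hm⟩ := exists_isMesh xs f hδ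
  obtain ⟨_, _⟩ := hm.nonempty
  refine ⟨Real.log (Fintype.card t') + Real.log (Fintype.card t), fun β hβ => ?_⟩
  obtain ⟨hia, hib, hab⟩ := integral_lseTwo_bilinear_le hG hh hg hind₁ hind₂ (-1) β (epsTwo f)
    (fun (x : t) i => xs i x) (fun (y : t') k => (y : StrongDual ℝ F) (f k))
    (fun y => sum_sq_le_epsTwo_sq f (hm.norm_le y y.2))
  obtain ⟨hi1, he1⟩ := integral_affine_two hiT hiW (-β) (-(β * δ)) (-Real.log (Fintype.card t'))
  obtain ⟨hi2, he2⟩ := integral_affine_three hih hig hiV (-(β * lo)) (β * epsTwo f)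
    (β * (δ * epsTwoDual xs)) (Real.log (Fintype.card t))
  have hlower := integral_mono hi1 hia fun ω => by
    -- no row of the matrix has a maximum above the corresponding `‖T x‖`
    set A := lseTwo (-1) (fun (x : t) (y : t') =>
        β * ∑ i, ∑ k, G i k ω * (xs i x * (y : StrongDual ℝ F) (f k))) with hA
    have hmin : (-A - Real.log (Fintype.card t')) / β - δ * tensorModulus xs f (fun i k => G i k ω)
        ≤ sphereMin (tensorOperator xs f (fun i k => G i k ω)) := by
      refine le_sphereMin _ fun x hx => ?_
      obtain ⟨x', hx', hxx⟩ := hm.exists_near x hx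
      have h1 := norm_tensorOperator_le xs f (fun i k => G i k ω) (x := x') (x' := x) hδ.le
        (hm.norm_eq x' hx') fun i => by rw [abs_sub_comm]; exact hxx i
      have h2 := le_lse (fun x : t => -1 * lse fun (y : t') =>
        β * ∑ i, ∑ k, G i k ω * (xs i x * (y : StrongDual ℝ F) (f k))) ⟨x', hx'⟩
      have h3 : (lse fun (y : t') => β * ∑ i, ∑ k, G i k ω * (xs i x' * (y : StrongDual ℝ F) (f k)))
          ≤ β * ‖tensorOperator xs f (fun i k => G i k ω) x'‖ + Real.log (Fintype.card t') := by
        refine lse_le fun y => mul_le_mul_of_nonneg_left ?_ hβ.le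
        rw [← apply_tensorOperator]
        exact (le_abs_self _).trans (((y : StrongDual ℝ F).le_of_opNorm_le_of_le
          (hm.norm_le y y.2) le_rfl).trans (one_mul _).le)
      have h4 : (-A - Real.log (Fintype.card t')) / β
          ≤ ‖tensorOperator xs f (fun i k => G i k ω) x'‖ := by
        rw [div_le_iff₀' hβ, hA, lseTwo]
        linarith
      linarith
    rw [sub_le_iff_le_add, div_le_iff₀' hβ] at hmin
    linarith
  have hupper := integral_mono hib hi2 fun ω => by
    refine lse_le fun x => ?_
    rw [neg_one_mul, neg_le]
    -- a functional of the mesh that almost norms `∑ₖ hₖ fₖ` gives a large entry in each row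
    obtain ⟨y, hy, hy2⟩ := exists_dual_vector'' ℝ (∑ k, h k ω • f k)
    simp only [RCLike.ofReal_real_eq_id, id_eq, map_sum, map_smul, smul_eq_mul] at hy2
    obtain ⟨y', hy', hyy⟩ := hm.exists_near_dual y hy
    refine le_trans ?_ (le_lse (fun y : t' =>
      β * (√(∑ i, (xs i x) ^ 2) * (∑ k, h k ω * (y : StrongDual ℝ F) (f k))
          + epsTwo f * ∑ i, g i ω * xs i x)) ⟨y', hy'⟩)
    have hx := hm.norm_eq x x.2
    have h1 : ‖∑ k, h k ω • f k‖ - δ * ∑ k, |h k ω| ≤ ∑ k, h k ω * y' (f k) := by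
      rw [← hy2, sub_le_iff_le_add', ← sub_le_iff_le_add, ← Finset.sum_sub_distrib, Finset.mul_sum]
      refine Finset.sum_le_sum fun k _ => ?_
      rw [← mul_sub, mul_comm δ]
      refine (le_abs_self _).trans ?_
      rw [abs_mul]
      exact mul_le_mul_of_nonneg_left (hyy k) (abs_nonneg _)
    have h2 := mul_le_mul_of_nonneg_left h1 (Real.sqrt_nonneg (∑ i, (xs i x) ^ 2))
    have h3 := mul_le_mul_of_nonneg_right (hlo_le x hx) (norm_nonneg (∑ k, h k ω • f k))
    have h4 : √(∑ i, (xs i x) ^ 2) * (δ * ∑ k, |h k ω|) ≤ epsTwoDual xs * (δ * ∑ k, |h k ω|) :=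
      mul_le_mul_of_nonneg_right (le_epsTwoDual xs hx.le)
        (mul_nonneg hδ.le (Finset.sum_nonneg fun _ _ => abs_nonneg _))
    have h5 := mul_le_mul_of_nonneg_left
      (neg_le_of_abs_le (abs_sum_mul_apply_le_norm xs (fun i => g i ω) hx)) (epsTwo_nonneg f)
    have h6 : lo * ‖∑ k, h k ω • f k‖ - epsTwo f * ‖∑ i, g i ω • xs i‖
        - epsTwoDual xs * (δ * ∑ k, |h k ω|) ≤
        √(∑ i, (xs i x) ^ 2) * (∑ k, h k ω * y' (f k)) + epsTwo f * ∑ i, g i ω * xs i x := by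
      linarith
    refine le_trans (le_of_eq ?_) (mul_le_mul_of_nonneg_left h6 hβ.le)
    ring
  have key := hlower.trans (hab.trans hupper)
  rw [he1, he2] at key
  linarith

end GordonChevet

theorem mainTheorem3
    {Ω : Type*} [MeasurableSpace Ω] (P : Measure Ω) [IsProbabilityMeasure P]
    {E : Type*} [NormedAddCommGroup E] [NormedSpace ℝ E] [CompleteSpace E] [Nontrivial E]
    {F : Type*} [NormedAddCommGroup F] [NormedSpace ℝ F] [CompleteSpace F]
    {n d : ℕ} (xs : Fin n → StrongDual ℝ E) (f : Fin d → F)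
    (G : Fin n → Fin d → Ω → ℝ) (h : Fin d → Ω → ℝ) (g : Fin n → Ω → ℝ)
    (hG : IsOrthonormalGaussian (fun p : Fin n × Fin d => G p.1 p.2) P)
    (hh : IsOrthonormalGaussian h P)
    (hg : IsOrthonormalGaussian g P)
    -- the three families are mutually independent
    (hind₁ : IndepFun (fun ω (p : Fin n × Fin d) => G p.1 p.2 ω)
      (fun ω => ((fun k => h k ω), (fun i => g i ω))) P)
    (hind₂ : IndepFun (fun ω k => h k ω) (fun ω i => g i ω) P) :
    -- all the expectations exist
    (Integrable (fun ω => ‖∑ k, h k ω • f k‖) P ∧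
      Integrable (fun ω => ‖∑ i, g i ω • xs i‖) P ∧
      Integrable (fun ω => sphereMin (tensorOperator xs f (fun i k => G i k ω))) P ∧
      Integrable (fun ω => sphereMax (tensorOperator xs f (fun i k => G i k ω))) P) ∧
    sInf {r : ℝ | ∃ x : E, ‖x‖ = 1 ∧ r = √(∑ i, (xs i x) ^ 2)} *
          (∫ ω, ‖∑ k, h k ω • f k‖ ∂P)
        - epsTwo f * (∫ ω, ‖∑ i, g i ω • xs i‖ ∂P)
      ≤ ∫ ω, sphereMin (tensorOperator xs f (fun i k => G i k ω)) ∂P ∧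
    ∫ ω, sphereMin (tensorOperator xs f (fun i k => G i k ω)) ∂P
      ≤ ∫ ω, sphereMax (tensorOperator xs f (fun i k => G i k ω)) ∂P ∧
    ∫ ω, sphereMax (tensorOperator xs f (fun i k => G i k ω)) ∂P
      ≤ epsTwoDual xs * (∫ ω, ‖∑ k, h k ω • f k‖ ∂P)
        + epsTwo f * (∫ ω, ‖∑ i, g i ω • xs i‖ ∂P) := by
  have hT := integrable_sphereMin_sphereMax (integrable_tensorOperator xs f hG)
  exact ⟨⟨hh.integrable_norm_sum_smul f, hg.integrable_norm_sum_smul xs, hT.1, hT.2⟩,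
    le_integral_sphereMin_tensorOperator xs f hG hh hg hind₁ hind₂,
    integral_mono hT.1 hT.2 fun ω => sphereMin_le_sphereMax _,
    integral_sphereMax_tensorOperator_le xs f hG hh hg hind₁ hind₂⟩
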